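/- Let $m,n\ge 0$, let $F=\bigvee_{r=1}^m S^{k_r}$ and $B=\bigvee_{j=1}^n S^{l_j}$ be finite wedges of spheres with all $k_r,l_j\ge 2$ (pointed at the wedge points), let $(E,e_0)$ be a pointed space, and let $F\xrightarrow{\,i\,}E\xrightarrow{\,p\,}B$ be a pointed fibration with homotopy fibre $F$; that is, $p$ is a Hurewicz fibration, $p\circ i$ is constant at the base point $b_0$, and $i$ is a pointed homotopy equivalence of $F$ onto the fibre $p^{-1}(b_0)$ (for instance, $i$ is the inclusion of the fibre). Let $s:B\to E$ be a homotopy section, i.e. a pointed map with $p\circ s\simeq \mathrm{Id}_B$ through base point preserving homotopies. Let $\alpha_j\in\pi_{l_j}(B)$ and $\beta_r\in\pi_{k_r}(F)$ be the classes of the inclusions $S^{l_j}\hookrightarrow B$ and $S^{k_r}\hookrightarrow F$ of the wedge summands. For $1\le j\le n$ and $1\le r\le m$ there is exactly one element $\{\alpha_j,\beta_r\}_s\in\pi_{l_j+k_r-1}(F)$, the James brace product, with $$i_*\{\alpha_j,\beta_r\}_s=[s_*\alpha_j,\,i_*\beta_r]\in\pi_{l_j+k_r-1}(E),$$ where $[\cdot,\cdot]$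 is the Whitehead product. Let $\varphi_s=\Omega s\cdot\Omega i:\Omega B\times\Omega F\to\Omega E$, $(\beta,\phi)\mapsto (s\circ\beta)\cdot(i\circ\phi)$, where $\cdot$ is concatenation of loops. Then $\varphi_s$ is an $H$-splitting, i.e. a (pointed) homotopy equivalence that is an $H$-map for the loop concatenation structures (with the product structure on $\Omega B\times\Omega F$), if and only if $\{\alpha_j,\beta_r\}_s=0$ for all $1\le j\le n$ and $1\le r\le m$. -/

import Mathlib

open scoped unitInterval Topology Topology.Homotopy

universe u v

noncomputable section

/-! ### Pointed homotopy equivalences, fibrations, homotopy sections -/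

/-- A pointed map `f : (X, x) → (Y, y)` that has a pointed homotopy inverse; all homotopies are
relative to the base points. -/
def IsPointedHomotopyEquiv {X : Type u} {Y : Type v} [TopologicalSpace X] [TopologicalSpace Y]
    (x : X) (y : Y) (f : C(X, Y)) : Prop :=
  f x = y ∧ ∃ g : C(Y, X), g y = x ∧
    (g.comp f).HomotopicRel (ContinuousMap.id X) {x} ∧
    (f.comp g).HomotopicRel (ContinuousMap.id Y) {y}

/-- Hurewicz fibrations: the homotopy lifting property for all spaces `A`. -/
def IsHurewiczFibration {E : Type u} {B : Type v} [TopologicalSpace E] [TopologicalSpace B]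
    (p : C(E, B)) : Prop :=
  ∀ (A : Type (max u v)) [TopologicalSpace A] (H : C(A × I, B)) (h : C(A, E)),
    (∀ a, p (h a) = H (a, 0)) →
      ∃ K : C(A × I, E), (∀ a, K (a, 0) = h a) ∧ ∀ z, p (K z) = H z

/-- `F —i→ E —p→ B` is a (pointed) fibration with homotopy fibre `F`: the map `p` is a Hurewicz
fibration, `p ∘ i` is constant, and `i` is a pointed homotopy equivalence of `F` onto the fibre
`p⁻¹(b₀)`. This includes the case where `i` is the inclusion of the fibre. -/
structure IsFibrationSequence {F : Type*} {E : Type u} {B : Type v} [TopologicalSpace F]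
    [TopologicalSpace E] [TopologicalSpace B] (f₀ : F) (e₀ : E) (b₀ : B)
    (i : C(F, E)) (p : C(E, B)) : Prop where
  map_base : i f₀ = e₀
  fibration : IsHurewiczFibration p
  comp_const : ∀ x, p (i x) = b₀
  fibre_equiv : IsPointedHomotopyEquiv f₀
    (⟨e₀, by rw [← map_base]; exact comp_const f₀⟩ : {e : E // p e = b₀})
    ⟨fun x => ⟨i x, comp_const x⟩, by fun_prop⟩

/-- `s` is a pointed map with `p ∘ s ≃ id` through a base point preserving homotopy. -/
structure IsHomotopySection {E B : Type*} [TopologicalSpace E] [TopologicalSpace B]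
    (e₀ : E) (b₀ : B) (p : C(E, B)) (s : C(B, E)) : Prop where
  map_base : s b₀ = e₀
  comp_homotopic : (p.comp s).HomotopicRel (ContinuousMap.id B) {b₀}

/-! ### Loop spaces and `H`-splittings -/

/-- `Ωf : ΩX → ΩY`. -/
def loopMap {X Y : Type*} [TopologicalSpace X] [TopologicalSpace Y] {x : X} {y : Y}
    (f : C(X, Y)) (hf : f x = y) : C(Ω X x, Ω Y y) where
  toFun γ := (γ.map f.continuous).cast hf.symm hf.symm
  continuous_toFun := by
    refine Path.continuous_uncurry_iff.mp ?_
    change Continuous fun q : Ω X x × I => f (q.1 q.2)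
    fun_prop

/-- `φ_s = Ωs · Ωi : ΩB × ΩF → ΩE`, `(β, φ) ↦ (s ∘ β) · (i ∘ φ)`. -/
def loopSplitting {F E B : Type*} [TopologicalSpace F] [TopologicalSpace E] [TopologicalSpace B]
    {f₀ : F} {e₀ : E} {b₀ : B} (s : C(B, E)) (hs : s b₀ = e₀) (i : C(F, E)) (hi : i f₀ = e₀) :
    C(Ω B b₀ × Ω F f₀, Ω E e₀) where
  toFun q := (loopMap s hs q.1).trans (loopMap i hi q.2)
  continuous_toFun := by fun_prop

/-- A map of `H`-spaces compatible with units, and with multiplications up to pointed homotopy. -/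
def IsHMap {X Y : Type*} [TopologicalSpace X] [TopologicalSpace Y] [HSpace X] [HSpace Y]
    (f : C(X, Y)) : Prop :=
  f HSpace.e = HSpace.e ∧
    (f.comp HSpace.hmul).HomotopicRel (HSpace.hmul.comp (f.prodMap f)) {(HSpace.e, HSpace.e)}

/-- An `H`-splitting: an `H`-map which is a pointed homotopy equivalence. -/
def IsHSplitting {X Y : Type*} [TopologicalSpace X] [TopologicalSpace Y] [HSpace X] [HSpace Y]
    (f : C(X, Y)) : Prop :=
  IsHMap f ∧ IsPointedHomotopyEquiv HSpace.e HSpace.e f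

/-! ### Homotopy groups: functoriality -/

/-- Postcomposition of a generalized loop with a pointed map. -/
def GenLoop.mapTo {N X Y : Type*} [TopologicalSpace X] [TopologicalSpace Y] {x : X} {y : Y}
    (f : C(X, Y)) (hf : f x = y) (g : Ω^ N X x) : Ω^ N Y y :=
  ⟨f.comp g.1, fun z hz => (congrArg f (g.2 z hz)).trans hf⟩

/-- The induced map `f_* : π_n(X, x) → π_n(Y, y)`. -/
def piMap {n : ℕ} {X Y : Type*} [TopologicalSpace X] [TopologicalSpace Y] {x : X} {y : Y}
    (f : C(X, Y)) (hf : f x = y) : π_ n X x → π_ n Y y :=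
  Quotient.map (GenLoop.mapTo f hf) fun _ _ h => h.map fun H => H.compContinuousMap f

/-! ### The Whitehead product -/

theorem continuous_ite_of_isClosed {A X : Type*} [TopologicalSpace A] [TopologicalSpace X]
    {P Q : A → Prop} [DecidablePred P] (hP : IsClosed {a | P a}) (hQ : IsClosed {a | Q a})
    (hPQ : ∀ a, P a ∨ Q a) {f g : A → X} (hf : Continuous f) (hg : Continuous g)
    (hfg : ∀ a, P a → Q a → f a = g a) : Continuous fun a => if P a then f a else g a := by
  have h1 : ContinuousOn (fun a => if P a then f a else g a) {a | P a} :=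
    hf.continuousOn.congr fun a (ha : P a) => if_pos ha
  have h2 : ContinuousOn (fun a => if P a then f a else g a) {a | Q a} := by
    refine hg.continuousOn.congr fun a (ha : Q a) => ?_
    by_cases hp : P a
    · simp [hp, hfg a hp ha]
    · simp [hp]
  have h := h1.union_of_isClosed h2 hP hQ
  rwa [show {a | P a} ∪ {a | Q a} = Set.univ from Set.eq_univ_of_forall hPQ,
    continuousOn_univ] at h

theorem Cube.isClosed_boundary (n : ℕ) : IsClosed (Cube.boundary (Fin n)) := by
  have : Cube.boundary (Fin n) = ⋃ j : Fin n, {y : Fin n → I | y j = 0 ∨ y j = 1} := by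
    ext y; simp [Cube.boundary]
  rw [this]
  refine isClosed_iUnion_of_finite fun j => ?_
  exact (isClosed_singleton.preimage (continuous_apply j)).union
    (isClosed_singleton.preimage (continuous_apply j))

namespace Whitehead

/-- Truncation of a real number to the unit interval. -/
def clamp (r : ℝ) : I := Set.projIcc 0 1 zero_le_one r

@[fun_prop]
theorem continuous_clamp : Continuous clamp := continuous_projIcc (h := zero_le_one)

theorem clamp_of_nonpos {r : ℝ} (h : r ≤ 0) : clamp r = 0 := Set.projIcc_of_le_left _ h

theorem clamp_of_one_le {r : ℝ} (h : 1 ≤ r) : clamp r = 1 := Set.projIcc_of_right_le _ h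

/-- `(edge₁, edge₂) : I → ∂I²` runs once around the boundary of the unit square, from the corner
`(0, 0)` through `(1, 0)`, `(1, 1)` and `(0, 1)` back to `(0, 0)`. -/
def edge₁ (τ : I) : I := clamp (min (4 * (τ : ℝ)) (3 - 4 * τ))

/-- See `edge₁`. -/
def edge₂ (τ : I) : I := clamp (min (4 * (τ : ℝ) - 1) (4 - 4 * τ))

/-- The map `I → I` that stretches the middle third over `I`. -/
def stretch (r : I) : I := clamp (3 * (r : ℝ) - 1)

/-- The tent function: `1` on the middle third of `I`, `0` at the ends. -/
def tent (r : I) : I := clamp (min (3 * (r : ℝ)) (3 - 3 * r))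

/-- The product of the tent functions: `1` on the inner cube of side `1 / 3`, `0` on the boundary
of the cube. -/
def collar {n : ℕ} (w : Fin n → I) : I := ∏ j, tent (w j)

/-- The first component of the parametrization
`(leftCoord, rightCoord) : (I^(a+b+1), ∂I^(a+b+1)) → (∂(I^(a+1) × I^(b+1)), ∂I^(a+1) × ∂I^(b+1))`
of the sphere `∂(I^(a+1) × I^(b+1))`. A point of `I^(a+b+1)` is `(τ, w)` with `w ∈ I^a × I^b`.
Where `w` lies in the inner cube of side `1 / 3`, the point goes to
`(edge₁ τ, x', edge₂ τ, y')` with `(x', y')` the stretched `w`; in the collar around it `(x', y')`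
is in the boundary of `I^a × I^b` and the boundary of the square is contracted to the corner
`(0, 0)` through the boundaries of the squares `[0, c]²`. The interior of `I × (inner cube)` is
mapped homeomorphically onto an open subset of the sphere and covers it once, so that the map has
degree one (for the orientation of the sphere that it defines). -/
def leftCoord (a b : ℕ) (u : Fin (a + b + 1) → I) : Fin (a + 1) → I :=
  Fin.cons (collar (Fin.tail u) * edge₁ (u 0)) fun j => stretch (Fin.tail u (Fin.castAdd b j))

/-- The second component of the parametrization described at `leftCoord`. -/
def rightCoord (a b : ℕ) (u : Fin (a + b + 1) → I) : Fin (b + 1) → I :=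
  Fin.cons (collar (Fin.tail u) * edge₂ (u 0)) fun j => stretch (Fin.tail u (Fin.natAdd a j))

theorem continuous_collar_tail (n : ℕ) :
    Continuous fun u : Fin (n + 1) → I => collar (Fin.tail u) := by
  unfold collar tent Fin.tail
  fun_prop

@[fun_prop]
theorem continuous_leftCoord (a b : ℕ) : Continuous (leftCoord a b) := by
  refine continuous_pi fun j => ?_
  refine Fin.cases ?_ (fun j => ?_) j
  · have := continuous_collar_tail (a + b)
    simp only [leftCoord, Fin.cons_zero, edge₁]
    fun_prop
  · simp only [leftCoord, Fin.cons_succ, stretch, Fin.tail]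
    fun_prop

@[fun_prop]
theorem continuous_rightCoord (a b : ℕ) : Continuous (rightCoord a b) := by
  refine continuous_pi fun j => ?_
  refine Fin.cases ?_ (fun j => ?_) j
  · have := continuous_collar_tail (a + b)
    simp only [rightCoord, Fin.cons_zero, edge₂]
    fun_prop
  · simp only [rightCoord, Fin.cons_succ, stretch, Fin.tail]
    fun_prop

theorem edge_mem (τ : I) : edge₁ τ = 0 ∨ edge₁ τ = 1 ∨ edge₂ τ = 0 ∨ edge₂ τ = 1 := by
  rcases le_total (4 * (τ : ℝ)) 1 with h | h
  · right; right; left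
    exact clamp_of_nonpos ((min_le_left _ _).trans (by linarith))
  rcases le_total (4 * (τ : ℝ)) 2 with h' | h'
  · right; left
    exact clamp_of_one_le (le_min (by linarith) (by linarith))
  rcases le_total (4 * (τ : ℝ)) 3 with h'' | h''
  · right; right; right
    exact clamp_of_one_le (le_min (by linarith) (by linarith))
  · left
    exact clamp_of_nonpos ((min_le_right _ _).trans (by linarith))

theorem tent_or_stretch (r : I) : tent r = 1 ∨ stretch r = 0 ∨ stretch r = 1 := by
  rcases le_total (3 * (r : ℝ)) 1 with h | h
  · right; left
    exact clamp_of_nonpos (by linarith)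
  rcases le_total (3 * (r : ℝ)) 2 with h' | h'
  · left
    exact clamp_of_one_le (le_min (by linarith) (by linarith))
  · right; right
    exact clamp_of_one_le (by linarith)

/-- The parametrization takes values in `∂(I^(a+1) × I^(b+1))`. -/
theorem coord_mem (a b : ℕ) (u : Fin (a + b + 1) → I) :
    leftCoord a b u ∈ Cube.boundary (Fin (a + 1)) ∨
      rightCoord a b u ∈ Cube.boundary (Fin (b + 1)) := by
  by_cases h : ∀ j, tent (Fin.tail u j) = 1
  · have hc : collar (Fin.tail u) = 1 := Finset.prod_eq_one fun j _ => h j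
    rcases edge_mem (u 0) with h | h | h | h
    · exact Or.inl ⟨0, Or.inl (by simp [leftCoord, h])⟩
    · exact Or.inl ⟨0, Or.inr (by simp [leftCoord, h, hc])⟩
    · exact Or.inr ⟨0, Or.inl (by simp [rightCoord, h])⟩
    · exact Or.inr ⟨0, Or.inr (by simp [rightCoord, h, hc])⟩
  · push Not at h
    obtain ⟨j, hj⟩ := h
    have hj' := (tent_or_stretch (Fin.tail u j)).resolve_left hj
    revert hj'
    refine Fin.addCases (fun j hj' => ?_) (fun j hj' => ?_) j
    · exact Or.inl ⟨j.succ, by simpa [leftCoord] using hj'⟩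
    · exact Or.inr ⟨j.succ, by simpa [rightCoord] using hj'⟩

/-- The parametrization maps the boundary of the cube to `∂I^(a+1) × ∂I^(b+1)`. -/
theorem coord_mem_of_boundary (a b : ℕ) {u : Fin (a + b + 1) → I}
    (hu : u ∈ Cube.boundary (Fin (a + b + 1))) :
    leftCoord a b u ∈ Cube.boundary (Fin (a + 1)) ∧
      rightCoord a b u ∈ Cube.boundary (Fin (b + 1)) := by
  suffices h : collar (Fin.tail u) = 0 ∨ (edge₁ (u 0) = 0 ∧ edge₂ (u 0) = 0) by
    rcases h with h | ⟨h, h'⟩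
    · exact ⟨⟨0, Or.inl (by simp [leftCoord, h])⟩, ⟨0, Or.inl (by simp [rightCoord, h])⟩⟩
    · exact ⟨⟨0, Or.inl (by simp [leftCoord, h])⟩, ⟨0, Or.inl (by simp [rightCoord, h'])⟩⟩
  obtain ⟨j, hj⟩ := hu
  revert hj
  refine Fin.cases (fun hj => ?_) (fun j hj => ?_) j
  · right
    rcases hj with hj | hj
    · exact ⟨clamp_of_nonpos ((min_le_left _ _).trans (by simp [hj])),
        clamp_of_nonpos ((min_le_left _ _).trans (by simp [hj]))⟩
    · exact ⟨clamp_of_nonpos ((min_le_right _ _).trans (by rw [hj]; norm_num)),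
        clamp_of_nonpos ((min_le_right _ _).trans (by rw [hj]; norm_num))⟩
  · left
    refine Finset.prod_eq_zero (Finset.mem_univ j) ?_
    rcases hj with hj | hj
    · exact clamp_of_nonpos ((min_le_left _ _).trans (by simp [Fin.tail, hj]))
    · exact clamp_of_nonpos ((min_le_right _ _).trans (by simp [Fin.tail, hj]))

open Classical in
/-- The map `f ∪ g` on `∂(I^(a+1) × I^(b+1)) = ∂I^(a+1) × I^(b+1) ∪ I^(a+1) × ∂I^(b+1)`, equal to
`g` on the first part and to `f` on the second, composed with the parametrization of
`∂(I^(a+1) × I^(b+1))` described at `leftCoord`. -/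
def genLoop {a b : ℕ} {X : Type*} [TopologicalSpace X] {x : X}
    (f : Ω^ (Fin (a + 1)) X x) (g : Ω^ (Fin (b + 1)) X x) : Ω^ (Fin (a + b + 1)) X x :=
  ⟨⟨fun u => if leftCoord a b u ∈ Cube.boundary (Fin (a + 1)) then g (rightCoord a b u)
      else f (leftCoord a b u),
    continuous_ite_of_isClosed (Q := fun u => rightCoord a b u ∈ Cube.boundary (Fin (b + 1)))
      ((Cube.isClosed_boundary _).preimage (continuous_leftCoord a b))
      ((Cube.isClosed_boundary _).preimage (continuous_rightCoord a b))
      (coord_mem a b)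
      (g.1.continuous.comp (continuous_rightCoord a b))
      (f.1.continuous.comp (continuous_leftCoord a b))
      fun u h1 h2 => (g.2 _ h2).trans (f.2 _ h1).symm⟩,
    fun u hu => by
      have h := coord_mem_of_boundary a b hu
      change (if leftCoord a b u ∈ Cube.boundary (Fin (a + 1)) then g (rightCoord a b u)
        else f (leftCoord a b u)) = x
      rw [if_pos h.1]
      exact g.2 _ h.2⟩

open Classical in
theorem genLoop_homotopic {a b : ℕ} {X : Type*} [TopologicalSpace X] {x : X}
    {f f' : Ω^ (Fin (a + 1)) X x} (hf : GenLoop.Homotopic f f')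
    {g g' : Ω^ (Fin (b + 1)) X x} (hg : GenLoop.Homotopic g g') :
    GenLoop.Homotopic (genLoop f g) (genLoop f' g') := by
  obtain ⟨H⟩ := hf
  obtain ⟨K⟩ := hg
  have hH : ∀ t, ∀ z ∈ Cube.boundary (Fin (a + 1)), H (t, z) = x := fun t z hz =>
    (H.eq_fst t hz).trans (f.2 z hz)
  have hK : ∀ t, ∀ z ∈ Cube.boundary (Fin (b + 1)), K (t, z) = x := fun t z hz =>
    (K.eq_fst t hz).trans (g.2 z hz)
  refine ⟨⟨⟨⟨fun q => if leftCoord a b q.2 ∈ Cube.boundary (Fin (a + 1))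
      then K (q.1, rightCoord a b q.2) else H (q.1, leftCoord a b q.2), ?_⟩, ?_, ?_⟩, ?_⟩⟩
  · refine continuous_ite_of_isClosed
      (Q := fun q : I × (Fin (a + b + 1) → I) =>
        rightCoord a b q.2 ∈ Cube.boundary (Fin (b + 1)))
      ((Cube.isClosed_boundary _).preimage ((continuous_leftCoord a b).comp continuous_snd))
      ((Cube.isClosed_boundary _).preimage ((continuous_rightCoord a b).comp continuous_snd))
      (fun q => coord_mem a b q.2) (by fun_prop) (by fun_prop) ?_
    intro q h1 h2
    exact (hK _ _ h2).trans (hH _ _ h1).symm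
  · intro u
    change (if _ then _ else _) = (if _ then _ else _)
    rw [H.apply_zero, K.apply_zero]
    rfl
  · intro u
    change (if _ then _ else _) = (if _ then _ else _)
    rw [H.apply_one, K.apply_one]
    rfl
  · intro t u hu
    have h := coord_mem_of_boundary a b hu
    change (if _ then _ else _) = (if _ then _ else _)
    rw [if_pos h.1, if_pos h.1, hK _ _ h.2]
    exact (g.2 _ h.2).symm

end Whitehead

/-- The Whitehead product `[α, β] ∈ π_{k+l-1}(X)` of `α ∈ π_k(X)` and `β ∈ π_l(X)`, where
`k = a + 1` and `l = b + 1`. -/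
def whiteheadProduct {a b : ℕ} {X : Type*} [TopologicalSpace X] {x : X} :
    π_ (a + 1) X x → π_ (b + 1) X x → π_ (a + b + 1) X x :=
  Quotient.map₂ Whitehead.genLoop fun _ _ hf _ _ hg => Whitehead.genLoop_homotopic hf hg

/-! ### The James brace product -/

/-- `γ` is a brace product of `α` and `β`: `i_* γ = [s_* α, i_* β]`. -/
def IsJamesBrace {F E B : Type*} [TopologicalSpace F] [TopologicalSpace E] [TopologicalSpace B]
    {f₀ : F} {e₀ : E} {b₀ : B} (s : C(B, E)) (hs : s b₀ = e₀) (i : C(F, E)) (hi : i f₀ = e₀)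
    {a b : ℕ} (α : π_ (a + 1) B b₀) (β : π_ (b + 1) F f₀) (γ : π_ (a + b + 1) F f₀) : Prop :=
  piMap i hi γ = whiteheadProduct (piMap s hs α) (piMap i hi β)

/-- The James brace product `{α, β}_s = (i_*)⁻¹ [s_* α, i_* β]`: the element `γ` with
`i_* γ = [s_* α, i_* β]`. -/
def jamesBrace {F E B : Type*} [TopologicalSpace F] [TopologicalSpace E] [TopologicalSpace B]
    {f₀ : F} {e₀ : E} {b₀ : B} (s : C(B, E)) (hs : s b₀ = e₀) (i : C(F, E)) (hi : i f₀ = e₀)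
    {a b : ℕ} (α : π_ (a + 1) B b₀) (β : π_ (b + 1) F f₀) : π_ (a + b + 1) F f₀ :=
  Classical.epsilon (IsJamesBrace s hs i hi α β)

/-! ### Spheres and wedges -/

/-- The `n`-sphere `S^n = I^n / ∂I^n` (for `n ≥ 1`). -/
def CubeSphere (n : ℕ) : Type :=
  Quot fun y z : Fin n → I => y ∈ Cube.boundary (Fin n) ∧ z ∈ Cube.boundary (Fin n)

instance (n : ℕ) : TopologicalSpace (CubeSphere n) := by
  unfold CubeSphere; infer_instance

/-- The base point of `S^n`: the class of `∂I^n`. -/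
def CubeSphere.base (n : ℕ) : CubeSphere n := Quot.mk _ fun _ => 0

/-- The quotient map `(I^n, ∂I^n) → (S^n, *)`. It represents the class of the identity map of `S^n`
in `π_n(S^n)`. -/
def CubeSphere.char (n : ℕ) : Ω^ (Fin n) (CubeSphere n) (CubeSphere.base n) :=
  ⟨⟨Quot.mk _, continuous_quot_mk⟩, fun _ hy =>
    Quot.sound ⟨hy, hy.elim fun j _ => ⟨j, Or.inl rfl⟩⟩⟩

/-- The wedge of a family of pointed spaces: the disjoint union of the spaces and of a point, with
that point and all the base points identified. -/
def Wedge {ι : Type*} (X : ι → Type*) (x : ∀ j, X j) : Type _ :=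
  Quot fun y z : Unit ⊕ (Σ j, X j) => y = Sum.inl () ∧ ∃ j, z = Sum.inr ⟨j, x j⟩

instance {ι : Type*} (X : ι → Type*) [∀ j, TopologicalSpace (X j)] (x : ∀ j, X j) :
    TopologicalSpace (Wedge X x) := by
  unfold Wedge; infer_instance

/-- The base point of a wedge. -/
def Wedge.base {ι : Type*} (X : ι → Type*) (x : ∀ j, X j) : Wedge X x := Quot.mk _ (Sum.inl ())

/-- The inclusion of the `j`-th summand of a wedge. -/
def Wedge.incl {ι : Type*} (X : ι → Type*) [∀ j, TopologicalSpace (X j)] (x : ∀ j, X j) (j : ι) :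
    C(X j, Wedge X x) :=
  ⟨fun y => Quot.mk _ (Sum.inr ⟨j, y⟩), by
    refine continuous_quot_mk.comp ?_
    fun_prop⟩

theorem Wedge.incl_base {ι : Type*} (X : ι → Type*) [∀ j, TopologicalSpace (X j)] (x : ∀ j, X j)
    (j : ι) : Wedge.incl X x j (x j) = Wedge.base X x :=
  (Quot.sound ⟨rfl, j, rfl⟩ : (Quot.mk _ (Sum.inl ()) : Wedge X x) = _).symm

/-- The finite wedge of spheres `⋁_j S^(d j)`. -/
abbrev SphereWedge {n : ℕ} (d : Fin n → ℕ) : Type :=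
  Wedge (fun j => CubeSphere (d j)) fun j => CubeSphere.base (d j)

/-- The base point of a wedge of spheres. -/
abbrev SphereWedge.base {n : ℕ} (d : Fin n → ℕ) : SphereWedge d := Wedge.base _ _

/-- The class in `π_{d j}` of the inclusion of the `j`-th sphere `S^(d j)` into the wedge. -/
def SphereWedge.inclClass {n : ℕ} (d : Fin n → ℕ) (j : Fin n) :
    π_ (d j) (SphereWedge d) (SphereWedge.base d) :=
  piMap (Wedge.incl _ _ j) (Wedge.incl_base _ _ j) ⟦CubeSphere.char (d j)⟧

end

noncomputable section

/-! ### Groups of relative homotopy classes of maps into a loop space -/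

/-! For any pair `(X, S)`, the classes relative to `S` of maps `X → ΩY` that are constant on `S`
form a group, `LoopClass S y`, and most of the proof is a computation in such groups. A fibration
with a homotopy section gives a split exact sequence `1 → [X, ΩF] → [X, ΩE] → [X, ΩB] → 1`
(`map_incl_injective`, `exists_map_incl_eq`, `map_proj_map_section`). For a cube and its boundary it
yields existence and uniqueness of the brace product, because `p_*[s_*α, i_*β]` is the Whitehead
product of `α` with a trivial class. Applied to the identity of `ΩE`, the universal element, it
shows that `φ_s` is always a pointed homotopy equivalence. Only the `H`-map condition remains, and
it says that `Ωs` and `Ωi` commute up to homotopy.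

Commutation is governed by the Whitehead products `[s_*α_j, i_*β_r]`, which vanish exactly when the
map `f ∪ g` on the boundary extends over the product of the two cubes. If all of them vanish, the
extensions glue to a map `μ : B × F → E` restricting to `s` and `i` (`exists_prod_map`); loops in
the two factors of `B × F` commute, hence so do their images under `Ωμ`
(`LoopClass.map_mul_comm_of_prod`).

Conversely, a commuting homotopy fills a square whose edges are a loop `s ∘ β` and a loop `i ∘ φ`.
Letting `β` and `φ` run over a cell of `B` and a cell of `F` gives a map on the product of cubes,
but with wrong boundary values: the homotopy is stationary only at the base point, not on all pairs
with one constant loop. Doubling the squares makes the error run out and back, so that it can be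
contracted (`hasExtension_of_squares`). -/

theorem homotopicRel_of_path {X Y : Type*} [TopologicalSpace X] [TopologicalSpace Y] {y : Y}
    {S : Set X} {f g : C(X, Ω Y y)} (H : I → X → Ω Y y)
    (hH : Continuous fun q : (I × X) × I => H q.1.1 q.1.2 q.2) (h0 : ∀ x, H 0 x = f x)
    (h1 : ∀ x, H 1 x = g x) (hS : ∀ t, ∀ x ∈ S, H t x = f x) : f.HomotopicRel g S :=
  ⟨⟨⟨⟨fun q => H q.1 q.2, Path.continuous_uncurry_iff.mp hH⟩, h0, h1⟩, hS⟩⟩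

/-- The concatenation of two families of loops. -/
def transMap {X Y : Type*} [TopologicalSpace X] [TopologicalSpace Y] {y : Y}
    (f g : C(X, Ω Y y)) : C(X, Ω Y y) :=
  ⟨fun x => (f x).trans (g x), by fun_prop⟩

/-- The family of reversed loops. -/
def symmMap {X Y : Type*} [TopologicalSpace X] [TopologicalSpace Y] {y : Y}
    (f : C(X, Ω Y y)) : C(X, Ω Y y) :=
  ⟨fun x => (f x).symm, Path.continuous_symm.comp f.continuous⟩

/-- Families of loops `X → ΩY` which are constant on `S`. -/
def LoopFamily {X Y : Type*} [TopologicalSpace X] [TopologicalSpace Y] (S : Set X) (y : Y) :=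
  {f : C(X, Ω Y y) // ∀ x ∈ S, f x = Path.refl y}

namespace LoopFamily

variable {X Y : Type*} [TopologicalSpace X] [TopologicalSpace Y] {S : Set X} {y : Y}

instance setoid (S : Set X) (y : Y) : Setoid (LoopFamily S y) where
  r f g := f.1.HomotopicRel g.1 S
  iseqv := ⟨fun _ => .refl _, fun h => h.symm, fun h h' => h.trans h'⟩

instance : Mul (LoopFamily S y) where
  mul f g := ⟨transMap f.1 g.1, fun x hx => by simp [transMap, f.2 x hx, g.2 x hx]⟩

instance : One (LoopFamily S y) := ⟨⟨.const _ (Path.refl y), fun _ _ => rfl⟩⟩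

instance : Inv (LoopFamily S y) where
  inv f := ⟨symmMap f.1, fun x hx => by simp [symmMap, f.2 x hx]⟩

theorem equiv_of_path {f g : LoopFamily S y} (H : I → X → Ω Y y)
    (hH : Continuous fun q : (I × X) × I => H q.1.1 q.1.2 q.2) (h0 : ∀ x, H 0 x = f.1 x)
    (h1 : ∀ x, H 1 x = g.1 x) (hS : ∀ t, ∀ x ∈ S, H t x = Path.refl y) : f ≈ g :=
  homotopicRel_of_path H hH h0 h1 fun t x hx => (hS t x hx).trans (f.2 x hx).symm

theorem mul_equiv {f f' g g' : LoopFamily S y} (hf : f ≈ f') (hg : g ≈ g') : f * g ≈ f' * g' := by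
  obtain ⟨F⟩ : f.1.HomotopicRel f'.1 S := hf
  obtain ⟨G⟩ : g.1.HomotopicRel g'.1 S := hg
  refine equiv_of_path (fun t x => (F (t, x)).trans (G (t, x)))
    (Path.continuous_uncurry_iff.mpr (F.continuous.path_trans G.continuous)) ?_ ?_ ?_
  · intro x; rw [F.apply_zero, G.apply_zero]; rfl
  · intro x; rw [F.apply_one, G.apply_one]; rfl
  · intro t x hx
    have hF : F (t, x) = Path.refl y := (F.eq_fst t hx).trans (f.2 x hx)
    have hG : G (t, x) = Path.refl y := (G.eq_fst t hx).trans (g.2 x hx)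
    rw [hF, hG, Path.refl_trans_refl]

theorem inv_equiv {f f' : LoopFamily S y} (hf : f ≈ f') : f⁻¹ ≈ f'⁻¹ := by
  obtain ⟨F⟩ : f.1.HomotopicRel f'.1 S := hf
  refine equiv_of_path (fun t x => (F (t, x)).symm)
    (Path.continuous_uncurry_iff.mpr (Path.continuous_symm.comp F.continuous)) ?_ ?_ ?_
  · intro x; rw [F.apply_zero]; rfl
  · intro x; rw [F.apply_one]; rfl
  · intro t x hx
    have hF : F (t, x) = Path.refl y := (F.eq_fst t hx).trans (f.2 x hx)
    rw [hF, Path.refl_symm]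

/-- The linear homotopy from the identity to `ρ` is jointly continuous in the loop and leaves
constant loops constant, so reparametrization of single loops carries over to families relative to
`S`. -/
theorem reparam_equiv {f g : LoopFamily S y} (ρ : I → I) (hρ : Continuous ρ) (h0 : ρ 0 = 0)
    (h1 : ρ 1 = 1) (h : ∀ x, g.1 x = (f.1 x).reparam ρ hρ h0 h1) : f ≈ g := by
  refine equiv_of_path (fun t x => (Path.Homotopy.reparam (f.1 x) ρ hρ h0 h1).eval t) ?_ ?_ ?_ ?_
  · change Continuous fun q : (I × X) × I => f.1 q.1.2
      ⟨σ q.1.1 * q.2 + q.1.1 * ρ q.2, _⟩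
    fun_prop
  · intro x; simp
  · intro x; simp [h]
  · intro t x hx
    ext z
    change f.1 x _ = _
    rw [f.2 x hx]
    rfl

theorem mul_assoc_equiv (f g h : LoopFamily S y) : f * g * h ≈ f * (g * h) :=
  Setoid.symm (reparam_equiv _ _ _ _ fun x =>
    Path.Homotopy.trans_assoc_reparam (f.1 x) (g.1 x) (h.1 x))

theorem one_mul_equiv (f : LoopFamily S y) : 1 * f ≈ f := by
  refine equiv_of_path (fun t x => Path.delayReflLeft t (f.1 x))
    (Path.continuous_uncurry_iff.mpr (Path.continuous_delayReflLeft.comp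
      (f := fun q : I × X => (q.1, f.1 q.2)) (by fun_prop))) ?_ ?_ ?_
  · intro x; exact Path.delayReflLeft_zero _
  · intro x; exact Path.delayReflLeft_one _
  · intro t x hx
    rw [f.2 x hx]
    rfl

theorem mul_inv_equiv (f : LoopFamily S y) : f * f⁻¹ ≈ 1 := by
  refine Setoid.symm (equiv_of_path (fun t x => (Path.Homotopy.reflTransSymm (f.1 x)).eval t)
    ?_ ?_ ?_ ?_)
  · change Continuous fun q : (I × X) × I => f.1 q.1.2
      ⟨Path.Homotopy.reflTransSymmAux (q.1.1, q.2), _⟩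
    fun_prop
  · intro x; simp; rfl
  · intro x; simp; rfl
  · intro t x hx
    ext z
    change f.1 x _ = _
    rw [f.2 x hx]
    rfl

theorem inv_mul_equiv (f : LoopFamily S y) : f⁻¹ * f ≈ 1 := by
  have h : f⁻¹⁻¹ = f := Subtype.ext (ContinuousMap.ext fun x => Path.symm_symm _)
  simpa only [h] using mul_inv_equiv f⁻¹

/-- Postcomposition with a pointed map. -/
def map {Z : Type*} [TopologicalSpace Z] {z : Z} (p : C(Y, Z)) (hp : p y = z)
    (f : LoopFamily S y) : LoopFamily S z :=
  ⟨(loopMap p hp).comp f.1, fun x hx => by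
    ext t
    change p (f.1 x t) = z
    rw [f.2 x hx]
    exact hp⟩

theorem map_equiv {Z : Type*} [TopologicalSpace Z] {z : Z} (p : C(Y, Z)) (hp : p y = z)
    {f g : LoopFamily S y} (h : f ≈ g) : map p hp f ≈ map p hp g :=
  h.map fun H => H.compContinuousMap (loopMap p hp)

theorem map_mul {Z : Type*} [TopologicalSpace Z] {z : Z} (p : C(Y, Z)) (hp : p y = z)
    (f g : LoopFamily S y) : map p hp (f * g) = map p hp f * map p hp g := by
  refine Subtype.ext (ContinuousMap.ext fun x => ?_)
  ext t
  change p (((f.1 x).trans (g.1 x)) t) = ((loopMap p hp (f.1 x)).trans (loopMap p hp (g.1 x))) t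
  simp only [Path.trans_apply]
  split_ifs <;> rfl

theorem map_equiv_of_homotopicRel {Z : Type*} [TopologicalSpace Z] {z : Z} {p q : C(Y, Z)}
    (hp : p y = z) (hq : q y = z) (h : p.HomotopicRel q {y}) (f : LoopFamily S y) :
    map p hp f ≈ map q hq f := by
  obtain ⟨H⟩ := h
  have hH : ∀ t, H (t, y) = z := fun t => (H.eq_fst t rfl).trans hp
  refine equiv_of_path (fun t x => loopMap ⟨fun w => H (t, w), by fun_prop⟩ (hH t) (f.1 x))
    ?_ ?_ ?_ ?_
  · change Continuous fun q : (I × X) × I => H (q.1.1, f.1 q.1.2 q.2)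
    fun_prop
  · intro x; ext t; exact H.apply_zero _
  · intro x; ext t; exact H.apply_one _
  · intro t x hx
    ext z
    change H (t, f.1 x z) = _
    rw [f.2 x hx]
    exact hH t

/-- Precomposition with a map of pairs. -/
def comap {X' : Type*} [TopologicalSpace X'] {S' : Set X'} (u : C(X', X))
    (hu : ∀ x ∈ S', u x ∈ S) (f : LoopFamily S y) : LoopFamily S' y :=
  ⟨f.1.comp u, fun x hx => f.2 _ (hu x hx)⟩

theorem comap_equiv {X' : Type*} [TopologicalSpace X'] {S' : Set X'} (u : C(X', X))
    (hu : ∀ x ∈ S', u x ∈ S) {f g : LoopFamily S y} (h : f ≈ g) : comap u hu f ≈ comap u hu g := by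
  obtain ⟨H⟩ : f.1.HomotopicRel g.1 S := h
  refine equiv_of_path (fun t x => H (t, u x))
    (Path.continuous_uncurry_iff.mpr
      (H.continuous.comp (continuous_fst.prodMk (u.continuous.comp continuous_snd))))
    (fun x => H.apply_zero _) (fun x => H.apply_one _)
    fun t x hx => (H.eq_fst t (hu x hx)).trans (f.2 _ (hu x hx))

end LoopFamily

/-- The group of homotopy classes, relative to `S`, of families of loops which are constant
on `S`. -/
def LoopClass {X Y : Type*} [TopologicalSpace X] [TopologicalSpace Y] (S : Set X) (y : Y) :=
  Quotient (LoopFamily.setoid S y)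

namespace LoopClass

variable {X Y Z : Type*} [TopologicalSpace X] [TopologicalSpace Y] [TopologicalSpace Z]
  {S : Set X} {y : Y} {z : Z}

/-- The class of a family of loops. -/
def mk (f : LoopFamily S y) : LoopClass S y := Quotient.mk _ f

theorem mk_eq {f g : LoopFamily S y} : mk f = mk g ↔ f.1.HomotopicRel g.1 S := Quotient.eq

instance : Group (LoopClass S y) :=
  letI : Mul (LoopClass S y) :=
    ⟨Quotient.map₂ (· * ·) fun _ _ h _ _ h' => LoopFamily.mul_equiv h h'⟩
  letI : One (LoopClass S y) := ⟨mk 1⟩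
  letI : Inv (LoopClass S y) := ⟨Quotient.map (·⁻¹) fun _ _ h => LoopFamily.inv_equiv h⟩
  Group.ofLeftAxioms
    (by rintro ⟨f⟩ ⟨g⟩ ⟨h⟩; exact Quotient.sound (LoopFamily.mul_assoc_equiv f g h))
    (by rintro ⟨f⟩; exact Quotient.sound (LoopFamily.one_mul_equiv f))
    (by rintro ⟨f⟩; exact Quotient.sound (LoopFamily.inv_mul_equiv f))

theorem mk_mul (f g : LoopFamily S y) : mk (f * g) = mk f * mk g := rfl

theorem mk_one : mk (1 : LoopFamily S y) = 1 := rfl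

/-- Postcomposition with a pointed map, as a homomorphism. -/
def map (p : C(Y, Z)) (hp : p y = z) : LoopClass S y →* LoopClass S z :=
  MonoidHom.mk' (Quotient.map (LoopFamily.map p hp) fun _ _ h => LoopFamily.map_equiv p hp h) (by
    rintro ⟨f⟩ ⟨g⟩
    exact congrArg mk (LoopFamily.map_mul p hp f g))

theorem map_eq_of_homotopicRel {p q : C(Y, Z)} (hp : p y = z) (hq : q y = z)
    (h : p.HomotopicRel q {y}) (a : LoopClass S y) : map p hp a = map q hq a := by
  obtain ⟨f⟩ := a
  exact Quotient.sound (LoopFamily.map_equiv_of_homotopicRel hp hq h f)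

theorem map_map {W : Type*} [TopologicalSpace W] {w : W} (p : C(Y, Z)) (hp : p y = z)
    (q : C(Z, W)) (hq : q z = w) (a : LoopClass S y) :
    map q hq (map p hp a) = map (q.comp p) (by simp [hp, hq]) a := by
  obtain ⟨f⟩ := a
  rfl

theorem map_id (a : LoopClass S y) : map (ContinuousMap.id Y) rfl a = a := by
  obtain ⟨f⟩ := a
  rfl

theorem map_eq_one_of_const {p : C(Y, Z)} (hp : p y = z) (h : ∀ w, p w = z)
    (a : LoopClass S y) : map p hp a = 1 := by
  obtain ⟨f⟩ := a
  refine congrArg mk (Subtype.ext (ContinuousMap.ext fun x => ?_))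
  ext t
  exact h _

/-- Precomposition with a map of pairs, as a homomorphism. -/
def comap {X' : Type*} [TopologicalSpace X'] {S' : Set X'} (u : C(X', X))
    (hu : ∀ x ∈ S', u x ∈ S) : LoopClass S y →* LoopClass S' y :=
  MonoidHom.mk' (Quotient.map (LoopFamily.comap u hu) fun _ _ h => LoopFamily.comap_equiv u hu h)
    (by
      rintro ⟨f⟩ ⟨g⟩
      rfl)

theorem comap_map {X' : Type*} [TopologicalSpace X'] {S' : Set X'} (u : C(X', X))
    (hu : ∀ x ∈ S', u x ∈ S) (p : C(Y, Z)) (hp : p y = z) (a : LoopClass S y) :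
    comap u hu (map p hp a) = map p hp (comap u hu a) := by
  obtain ⟨f⟩ := a
  rfl

end LoopClass

/-! ### Regular lifting functions -/

/-- The initial data of the path lifting problem for `p`. -/
def LiftData {E : Type u} {B : Type v} [TopologicalSpace E] [TopologicalSpace B] (p : C(E, B)) :
    Type (max u v) :=
  {q : E × C(I, B) // p q.1 = q.2 0}

instance {E : Type u} {B : Type v} [TopologicalSpace E] [TopologicalSpace B] (p : C(E, B)) :
    TopologicalSpace (LiftData p) := by
  unfold LiftData; infer_instance

/-- The largest value of `d` along a path. -/
def pathHeight {B : Type v} [TopologicalSpace B] (d : C(B, I)) (ω : C(I, B)) : I :=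
  Whitehead.clamp ‖(⟨fun t => (d (ω t) : ℝ), by fun_prop⟩ : C(I, ℝ))‖

theorem continuous_pathHeight {B : Type v} [TopologicalSpace B] (d : C(B, I)) :
    Continuous (pathHeight d) := by
  refine Whitehead.continuous_clamp.comp (continuous_norm.comp ?_)
  exact (ContinuousMap.continuous_postcomp ⟨fun b => (d b : ℝ), by fun_prop⟩)

theorem pathHeight_eq_zero {B : Type v} [TopologicalSpace B] (d : C(B, I)) {ω : C(I, B)} :
    pathHeight d ω = 0 ↔ ∀ t, d (ω t) = 0 := by
  set g : C(I, ℝ) := ⟨fun t => (d (ω t) : ℝ), by fun_prop⟩ with hg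
  have h1 : pathHeight d ω = 0 ↔ ‖g‖ ≤ 0 := by
    change Whitehead.clamp ‖g‖ = 0 ↔ _
    exact Set.projIcc_eq_left zero_lt_one
  rw [h1, norm_le_zero_iff, DFunLike.ext_iff]
  exact forall_congr' fun t => ⟨fun h => Subtype.ext h, fun h => congrArg Subtype.val h⟩

/-- Running through a path `ω` in time `pathHeight d ω` depends continuously on `ω`. -/
theorem continuous_compressed {B : Type v} [TopologicalSpace B] {b₀ : B} (d : C(B, I))
    (hd : ∀ b, d b = 0 ↔ b = b₀) :
    Continuous fun q : C(I, B) × I =>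
      q.1 (Whitehead.clamp ((q.2 : ℝ) / (pathHeight d q.1 : ℝ))) := by
  rw [continuous_iff_continuousAt]
  rintro ⟨ω, t⟩
  -- At height zero the quotient gives no control over nearby paths. But `ω` is then constant at
  -- `b₀`, and paths close to it in the compact-open topology stay in a given neighbourhood of `b₀`,
  -- wherever they are evaluated.
  by_cases h : pathHeight d ω = 0
  · have hω : ∀ t, ω t = b₀ := fun t => (hd _).1 ((pathHeight_eq_zero d).1 h t)
    intro U hU
    simp only [hω] at hU
    obtain ⟨V, hVU, hV, hb⟩ := mem_nhds_iff.1 hU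
    have hW : {ω' : C(I, B) | Set.MapsTo ω' Set.univ V} ∈ 𝓝 ω :=
      (ContinuousMap.isOpen_setOfPred_mapsTo isCompact_univ hV).mem_nhds fun t _ => by
        rw [hω]; exact hb
    rw [Filter.mem_map]
    filter_upwards [(continuous_fst.tendsto (ω, t)).eventually hW] with q hq
    exact hVU (hq (Set.mem_univ _))
  · have hc : ContinuousAt (fun q : C(I, B) × I => (q.2 : ℝ) / (pathHeight d q.1 : ℝ)) (ω, t) := by
      refine ContinuousAt.div (by fun_prop) ?_ fun h' => h (Subtype.ext h')
      exact (continuous_subtype_val.comp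
        ((continuous_pathHeight d).comp continuous_fst)).continuousAt
    exact continuousAt_fst.eval (Whitehead.continuous_clamp.continuousAt.comp hc)

/-- A general lifting function may move the lift of a constant path, and then homotopies relative to
a subset do not lift relative to it. The cure is to lift the path compressed into time `pathHeight d
ω` and to undo the compression afterwards: a path constant at `b₀` has height zero, so only the
starting point of its lift is used. -/
theorem IsHurewiczFibration.exists_regular_lifting {E : Type u} {B : Type v} [TopologicalSpace E]
    [TopologicalSpace B] {p : C(E, B)} (hp : IsHurewiczFibration p) {b₀ : B} (d : C(B, I))
    (hd : ∀ b, d b = 0 ↔ b = b₀) :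
    ∃ L : C(LiftData p × I, E), (∀ a, L (a, 0) = a.1.1) ∧ (∀ a t, p (L (a, t)) = a.1.2 t) ∧
      ∀ a : LiftData p, (∀ t, a.1.2 t = b₀) → ∀ t, L (a, t) = a.1.1 := by
  have hcoe : Continuous fun a : LiftData p => a.1 := continuous_subtype_val
  -- The universal path lifting problem; `LiftData p` lies in the universe of the test spaces of
  -- `IsHurewiczFibration`.
  obtain ⟨K, hK0, hK⟩ := hp (LiftData p)
    ⟨fun q => q.1.1.2 q.2, by
      exact (continuous_snd.comp (hcoe.comp continuous_fst)).eval continuous_snd⟩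
    ⟨fun a => a.1.1, continuous_fst.comp hcoe⟩ fun a => a.2
  let c : C(C(I, B), C(I, B)) := ContinuousMap.curry ⟨_, continuous_compressed d hd⟩
  have hc : ∀ ω t, c ω t = ω (Whitehead.clamp ((t : ℝ) / (pathHeight d ω : ℝ))) := fun _ _ => rfl
  have hc0 : ∀ ω, c ω 0 = ω 0 := fun ω => by
    rw [hc, Whitehead.clamp_of_nonpos]
    simp
  have hr : Continuous fun a : LiftData p => (a.1.1, c a.1.2) :=
    (continuous_fst.comp hcoe).prodMk (c.continuous.comp (continuous_snd.comp hcoe))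
  have hr' : ∀ a : LiftData p, p a.1.1 = c a.1.2 0 := fun a => by rw [hc0]; exact a.2
  let r : C(LiftData p, LiftData p) := ⟨fun a => ⟨(a.1.1, c a.1.2), hr' a⟩, hr.subtype_mk hr'⟩
  refine ⟨⟨fun q => K (r q.1, pathHeight d q.1.1.2 * q.2), ?_⟩, ?_, ?_, ?_⟩
  · have := (continuous_pathHeight d).comp (continuous_snd.comp hcoe)
    refine K.continuous.comp ((r.continuous.comp continuous_fst).prodMk ?_)
    exact (this.comp continuous_fst).mul continuous_snd
  · intro a
    change K (r a, _ * 0) = _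
    rw [mul_zero, hK0]
    rfl
  · intro a t
    change p (K (r a, pathHeight d a.1.2 * t)) = _
    rw [hK]
    change c a.1.2 (pathHeight d a.1.2 * t) = _
    rw [hc]
    by_cases h : pathHeight d a.1.2 = 0
    · have h' : ∀ t, a.1.2 t = b₀ := fun t => (hd _).1 ((pathHeight_eq_zero d).1 h t)
      rw [h', h']
    · congr 1
      have h' : (pathHeight d a.1.2 : ℝ) ≠ 0 := fun h' => h (Subtype.ext h')
      rw [Set.Icc.coe_mul, mul_div_cancel_left₀ _ h']
      exact Set.projIcc_val _ _
  · intro a ha t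
    change K (r a, pathHeight d a.1.2 * t) = _
    rw [(pathHeight_eq_zero d).2 fun t => (hd _).2 (ha t), zero_mul, hK0]
    rfl

/-- A map whose composite with a fibration is nullhomotopic relative to `T` is homotopic
relative to `T` to a map into the fibre. -/
theorem IsHurewiczFibration.exists_homotopicRel_fibre {E : Type u} {B : Type v}
    [TopologicalSpace E] [TopologicalSpace B] {p : C(E, B)} (hp : IsHurewiczFibration p) {b₀ : B}
    (d : C(B, I)) (hd : ∀ b, d b = 0 ↔ b = b₀) {Z : Type*} [TopologicalSpace Z] {T : Set Z}
    (w : C(Z, E)) (hw : (p.comp w).HomotopicRel (.const Z b₀) T) :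
    ∃ w' : C(Z, E), w.HomotopicRel w' T ∧ ∀ z, p (w' z) = b₀ := by
  obtain ⟨L, hL0, hLp, hLc⟩ := hp.exists_regular_lifting d hd
  obtain ⟨H⟩ := hw
  let G : C(Z, C(I, B)) := ContinuousMap.curry ⟨fun q : Z × I => H (q.2, q.1), by fun_prop⟩
  have hG : ∀ z t, G z t = H (t, z) := fun _ _ => rfl
  let a : C(Z, LiftData p) :=
    ⟨fun z => ⟨(w z, G z), (H.apply_zero z).symm⟩,
      Continuous.subtype_mk (w.continuous.prodMk G.continuous) _⟩
  refine ⟨⟨fun z => L (a z, 1), by fun_prop⟩,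
    ⟨⟨⟨⟨fun q => L (a q.2, q.1), by fun_prop⟩, fun z => hL0 _, fun z => rfl⟩, ?_⟩⟩, ?_⟩
  · intro t z hz
    refine hLc _ (fun t => ?_) t
    exact (H.eq_fst t hz).trans (H.fst_eq_snd hz)
  · intro z
    exact (hLp (a z) 1).trans (H.apply_one z)

/-! ### The exact sequence of loop classes of a fibration with a homotopy section -/

/-- The adjoint map `X × I → E` is pushed into the fibre relative to `S × I ∪ X × {0, 1}`; fixing
the two ends makes the result a family of loops again. -/
theorem IsHurewiczFibration.exists_loopMap_fibre {E : Type u} {B : Type v}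
    [TopologicalSpace E] [TopologicalSpace B] {p : C(E, B)} (hp : IsHurewiczFibration p) {b₀ : B}
    (d : C(B, I)) (hd : ∀ b, d b = 0 ↔ b = b₀) {e₀ : E} (he : p e₀ = b₀) {X : Type*}
    [TopologicalSpace X] {S : Set X} (f : C(X, Ω E e₀))
    (hf : ((loopMap p he).comp f).HomotopicRel (.const X (Path.refl b₀)) S) :
    ∃ f' : C(X, Ω {e : E // p e = b₀} ⟨e₀, he⟩),
      f.HomotopicRel ((loopMap (y := e₀) ⟨Subtype.val, continuous_subtype_val⟩ rfl).comp f') S := by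
  obtain ⟨H⟩ := hf
  let w : C(X × I, E) := ⟨fun q => f q.1 q.2, by fun_prop⟩
  obtain ⟨w', ⟨K⟩, hw'⟩ := hp.exists_homotopicRel_fibre (b₀ := b₀) d hd
    (T := {q : X × I | q.1 ∈ S ∨ q.2 = 0 ∨ q.2 = 1}) w (by
      refine ⟨⟨⟨⟨fun q => H (q.1, q.2.1) q.2.2, by fun_prop⟩, fun q => ?_, fun q => ?_⟩, ?_⟩⟩
      · change H (0, q.1) q.2 = _
        rw [H.apply_zero]
        rfl
      · change H (1, q.1) q.2 = _
        rw [H.apply_one]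
        rfl
      · rintro t ⟨x, τ⟩ (hx | rfl | rfl)
        · change H (t, x) τ = _
          rw [H.eq_fst t hx]
          rfl
        · change H (t, x) 0 = p (f x 0)
          rw [(H (t, x)).source, (f x).source, he]
        · change H (t, x) 1 = p (f x 1)
          rw [(H (t, x)).target, (f x).target, he])
  have hK : ∀ t x τ, τ = 0 ∨ τ = 1 → K (t, (x, τ)) = e₀ := fun t x τ hτ => by
    refine (K.eq_fst t (Or.inr hτ)).trans ?_
    change f x τ = e₀
    rcases hτ with rfl | rfl
    · exact (f x).source
    · exact (f x).target
  have hw0 : ∀ x τ, τ = 0 ∨ τ = 1 → w' (x, τ) = e₀ := fun x τ hτ =>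
    (K.apply_one _).symm.trans (hK 1 x τ hτ)
  refine ⟨⟨fun x => ⟨⟨fun t => ⟨w' (x, t), hw' _⟩, by fun_prop⟩,
    Subtype.ext (hw0 x 0 (Or.inl rfl)), Subtype.ext (hw0 x 1 (Or.inr rfl))⟩,
    Path.continuous_uncurry_iff.mp (w'.continuous.subtype_mk _)⟩, ?_⟩
  refine homotopicRel_of_path (fun t x => ⟨⟨fun τ => K (t, (x, τ)), by fun_prop⟩,
    hK t x 0 (Or.inl rfl), hK t x 1 (Or.inr rfl)⟩) ?_ (fun x => ?_) (fun x => ?_) ?_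
  · change Continuous fun q : (I × X) × I => K (q.1.1, (q.1.2, q.2))
    fun_prop
  · ext τ
    exact K.apply_zero _
  · ext τ
    exact K.apply_one _
  · intro t x hx
    ext τ
    exact K.eq_fst t (Or.inl hx)

theorem loopMap_refl {X Y : Type*} [TopologicalSpace X] [TopologicalSpace Y] {x : X} {y : Y}
    (f : C(X, Y)) (hf : f x = y) : loopMap f hf (Path.refl x) = Path.refl y := by
  ext t; exact hf

theorem loopSplitting_e {F E B : Type*} [TopologicalSpace F] [TopologicalSpace E]
    [TopologicalSpace B] {f₀ : F} {e₀ : E} {b₀ : B} (s : C(B, E)) (hs : s b₀ = e₀) (i : C(F, E))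
    (hi : i f₀ = e₀) : loopSplitting s hs i hi HSpace.e = HSpace.e := by
  change (loopMap s hs (Path.refl b₀)).trans (loopMap i hi (Path.refl f₀)) = Path.refl e₀
  rw [loopMap_refl, loopMap_refl, Path.refl_trans_refl]

namespace IsFibrationSequence

variable {F : Type*} {E : Type u} {B : Type v} [TopologicalSpace F] [TopologicalSpace E]
  [TopologicalSpace B] {f₀ : F} {e₀ : E} {b₀ : B} {i : C(F, E)} {p : C(E, B)}

theorem proj_base (h : IsFibrationSequence f₀ e₀ b₀ i p) : p e₀ = b₀ := by
  rw [← h.map_base]; exact h.comp_const f₀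

theorem map_proj_map_incl (h : IsFibrationSequence f₀ e₀ b₀ i p) {X : Type*} [TopologicalSpace X]
    {S : Set X} (a : LoopClass S f₀) :
    LoopClass.map p h.proj_base (LoopClass.map i h.map_base a) = 1 := by
  rw [LoopClass.map_map]
  exact LoopClass.map_eq_one_of_const _ h.comp_const a

/-- Exactness in the middle: the family is deformed into the strict fibre, and the inverse `g` of
the fibre equivalence carries it to `F`. -/
theorem exists_map_incl_eq (h : IsFibrationSequence f₀ e₀ b₀ i p) (d : C(B, I))
    (hd : ∀ b, d b = 0 ↔ b = b₀) {X : Type*} [TopologicalSpace X] {S : Set X}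
    (a : LoopClass S e₀) (ha : LoopClass.map p h.proj_base a = 1) :
    ∃ c : LoopClass S f₀, LoopClass.map i h.map_base c = a := by
  obtain ⟨w⟩ := a
  obtain ⟨w', hw'⟩ := h.fibration.exists_loopMap_fibre d hd h.proj_base w.1 (LoopClass.mk_eq.1 ha)
  obtain ⟨hi, g, hg, -, hig⟩ := h.fibre_equiv
  have hS : ∀ x ∈ S, w' x = Path.refl _ := fun x hx => by
    ext t
    have h1 := hw'.fst_eq_snd hx
    rw [w.2 x hx] at h1
    exact (congrArg (fun γ : Path e₀ e₀ => γ t) h1).symm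
  let c : LoopClass S (⟨e₀, h.proj_base⟩ : {e : E // p e = b₀}) := LoopClass.mk ⟨w', hS⟩
  refine ⟨LoopClass.map g hg c, ?_⟩
  have h1 := (LoopClass.map_map g hg _ hi c).trans
    ((LoopClass.map_eq_of_homotopicRel _ rfl hig c).trans (LoopClass.map_id c))
  have h2 := congrArg (LoopClass.map (z := e₀)
    (⟨Subtype.val, continuous_subtype_val⟩ : C({e : E // p e = b₀}, E)) rfl) h1
  rw [LoopClass.map_map] at h2
  exact h2.trans (LoopClass.mk_eq.2 hw'.symm)

/-- A null homotopy `H` in `E` projects to a family `δ` over `I × X` that need not be null.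
Multiplying `H` by the inverse of `s ∘ δ` makes the projection null relative to `T`, and the
corrected homotopy can be pushed into the fibre. -/
theorem map_incl_eq_one (h : IsFibrationSequence f₀ e₀ b₀ i p) {s : C(B, E)}
    (hs : IsHomotopySection e₀ b₀ p s) (d : C(B, I))
    (hd : ∀ b, d b = 0 ↔ b = b₀) {X : Type*} [TopologicalSpace X] {S : Set X}
    (a : LoopClass S f₀) (ha : LoopClass.map i h.map_base a = 1) : a = 1 := by
  obtain ⟨φ⟩ := a
  obtain ⟨H⟩ : (φ.map i h.map_base).1.HomotopicRel (1 : LoopFamily S e₀).1 S :=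
    LoopClass.mk_eq.1 ha
  let T : Set (I × X) := {q | q.2 ∈ S ∨ q.1 = 0 ∨ q.1 = 1}
  have hT : ∀ q ∈ T, ∀ t, p (H q t) = b₀ := by
    rintro ⟨t, x⟩ (hx | rfl | rfl) τ
    · rw [H.eq_fst t hx]
      exact h.comp_const _
    · rw [H.apply_zero]
      exact h.comp_const _
    · rw [H.apply_one]
      exact h.proj_base
  let δ : LoopFamily T b₀ := ⟨(loopMap p h.proj_base).comp H.toContinuousMap, fun q hq => by
    ext t; exact hT q hq t⟩
  let sδ : LoopFamily T e₀ := δ.map s hs.map_base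
  let W : C(I × X, Ω E e₀) := transMap H.toContinuousMap (sδ⁻¹).1
  have hδ : LoopClass.map p h.proj_base (LoopClass.mk sδ) = LoopClass.mk δ := by
    change LoopClass.map p h.proj_base (LoopClass.map s hs.map_base (LoopClass.mk δ)) = _
    rw [LoopClass.map_map]
    exact (LoopClass.map_eq_of_homotopicRel _ rfl hs.comp_homotopic _).trans (LoopClass.map_id _)
  have hW : ((loopMap p h.proj_base).comp W).HomotopicRel (.const _ (Path.refl b₀)) T := by
    have h1 : LoopClass.mk (δ * (sδ.map p h.proj_base)⁻¹) = 1 := by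
      change LoopClass.mk δ * (LoopClass.map p h.proj_base (LoopClass.mk sδ))⁻¹ = 1
      rw [hδ, mul_inv_cancel]
    have h2 : (loopMap p h.proj_base).comp W = (δ * (sδ.map p h.proj_base)⁻¹).1 := by
      refine ContinuousMap.ext fun q => ?_
      ext t
      change p (((H q).trans ((sδ⁻¹).1 q)) t) =
        ((δ.1 q).trans (((sδ.map p h.proj_base)⁻¹).1 q)) t
      simp only [Path.trans_apply]
      split_ifs <;> rfl
    rw [h2]
    exact LoopClass.mk_eq.1 h1
  obtain ⟨w', hw'⟩ := h.fibration.exists_loopMap_fibre d hd h.proj_base W hW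
  obtain ⟨hi, g, hg, hgi, -⟩ := h.fibre_equiv
  have hw : ∀ q ∈ T, ∀ t, (w' q t : E) = W q t := fun q hq t =>
    (congrArg (fun γ : Path e₀ e₀ => γ t) (hw'.fst_eq_snd hq)).symm
  have hsδ : ∀ q ∈ T, (sδ⁻¹).1 q = Path.refl e₀ := fun q hq => (sδ⁻¹).2 q hq
  let φ' : LoopFamily S (⟨e₀, h.proj_base⟩ : {e : E // p e = b₀}) := φ.map _ hi
  -- On `T` the correction is a constant loop, so the homotopy in the fibre starts at `φ' * 1`
  -- instead of `φ'`.
  have key : φ' * 1 ≈ 1 := by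
    refine LoopFamily.equiv_of_path (fun t x => w' (t, x))
      (Path.continuous_uncurry_iff.mpr w'.continuous) ?_ ?_ ?_
    · intro x
      ext t
      refine (hw (0, x) (Or.inr (Or.inl rfl)) t).trans ?_
      change ((H (0, x)).trans ((sδ⁻¹).1 (0, x))) t = (((φ'.1 x).trans (Path.refl _)) t : E)
      rw [hsδ (0, x) (Or.inr (Or.inl rfl)), H.apply_zero]
      simp only [Path.trans_apply]
      split_ifs <;> rfl
    · intro x
      ext t
      refine (hw (1, x) (Or.inr (Or.inr rfl)) t).trans ?_
      change ((H (1, x)).trans ((sδ⁻¹).1 (1, x))) t = e₀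
      rw [hsδ (1, x) (Or.inr (Or.inr rfl)), H.apply_one]
      simp only [Path.trans_apply]
      split_ifs <;> rfl
    · intro t x hx
      ext τ
      refine (hw (t, x) (Or.inl hx) τ).trans ?_
      change ((H (t, x)).trans ((sδ⁻¹).1 (t, x))) τ = e₀
      rw [hsδ (t, x) (Or.inl hx), H.eq_fst t hx, (φ.map i h.map_base).2 x hx]
      simp only [Path.trans_apply]
      split_ifs <;> rfl
  have h1 : LoopClass.map _ hi (LoopClass.mk φ) * 1 = 1 := Quotient.sound key
  rw [mul_one] at h1
  have h2 := (LoopClass.map_map _ hi g hg (LoopClass.mk φ)).trans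
    ((LoopClass.map_eq_of_homotopicRel _ rfl hgi _).trans (LoopClass.map_id _))
  rw [h1, map_one] at h2
  exact h2.symm

theorem map_incl_injective (h : IsFibrationSequence f₀ e₀ b₀ i p) {s : C(B, E)}
    (hs : IsHomotopySection e₀ b₀ p s) (d : C(B, I))
    (hd : ∀ b, d b = 0 ↔ b = b₀) {X : Type*} [TopologicalSpace X] (S : Set X) :
    Function.Injective (LoopClass.map (S := S) i h.map_base) :=
  (injective_iff_map_eq_one _).2 (h.map_incl_eq_one hs d hd)

theorem map_proj_map_section (h : IsFibrationSequence f₀ e₀ b₀ i p) {s : C(B, E)}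
    (hs : IsHomotopySection e₀ b₀ p s) {X : Type*} [TopologicalSpace X] {S : Set X}
    (a : LoopClass S b₀) : LoopClass.map p h.proj_base (LoopClass.map s hs.map_base a) = a := by
  rw [LoopClass.map_map]
  exact (LoopClass.map_eq_of_homotopicRel _ rfl hs.comp_homotopic _).trans (LoopClass.map_id _)

/-- The map `φ_s = Ωs · Ωi` is always a homotopy equivalence. -/
theorem isPointedHomotopyEquiv_loopSplitting (h : IsFibrationSequence f₀ e₀ b₀ i p) {s : C(B, E)}
    (hs : IsHomotopySection e₀ b₀ p s) (d : C(B, I)) (hd : ∀ b, d b = 0 ↔ b = b₀) :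
    IsPointedHomotopyEquiv (HSpace.e : Ω B b₀ × Ω F f₀) (HSpace.e : Ω E e₀)
      (loopSplitting s hs.map_base i h.map_base) := by
  -- The universal element, the identity of `ΩE`. Writing its class as `s_*β · i_*φ` exhibits `(β,
  -- φ)` as a right homotopy inverse of `φ_s`.
  let ε : LoopFamily {(HSpace.e : Ω E e₀)} e₀ := ⟨.id _, fun x hx => hx⟩
  let β : LoopFamily {(HSpace.e : Ω E e₀)} b₀ := ε.map p h.proj_base
  have h1 : LoopClass.map p h.proj_base
      ((LoopClass.map s hs.map_base (LoopClass.mk β))⁻¹ * LoopClass.mk ε) = 1 := by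
    rw [map_mul, map_inv, h.map_proj_map_section hs]
    exact inv_mul_cancel _
  obtain ⟨⟨φ⟩, hφ⟩ := h.exists_map_incl_eq d hd _ h1
  have hε : LoopClass.mk ε =
      LoopClass.map s hs.map_base (LoopClass.mk β) * LoopClass.map i h.map_base (.mk φ) :=
    eq_mul_of_inv_mul_eq hφ.symm
  let Φ := loopSplitting s hs.map_base i h.map_base
  have hΦ : Φ HSpace.e = HSpace.e := loopSplitting_e _ _ _ _
  refine ⟨hΦ, β.1.prodMk φ.1, Prod.ext (β.2 _ rfl) (φ.2 _ rfl), ?_, (LoopClass.mk_eq.1 hε).symm⟩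
  let u : LoopFamily {(HSpace.e : Ω B b₀ × Ω F f₀)} b₀ :=
    ⟨ContinuousMap.fst, fun x hx => by rw [Set.mem_singleton_iff.1 hx]; rfl⟩
  let v : LoopFamily {(HSpace.e : Ω B b₀ × Ω F f₀)} f₀ :=
    ⟨ContinuousMap.snd, fun x hx => by rw [Set.mem_singleton_iff.1 hx]; rfl⟩
  have hS : ∀ x ∈ ({HSpace.e} : Set (Ω B b₀ × Ω F f₀)), Φ x ∈ ({HSpace.e} : Set (Ω E e₀)) :=
    fun x hx => by rw [Set.mem_singleton_iff.1 hx]; exact hΦ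
  -- For the other composite the factorization is pulled back along `Φ`, where `ε` becomes the
  -- tautological product `s_*u · i_*v`. Applying `p_*` identifies the first factors; cancellation
  -- and injectivity of `i_*` identify the second ones.
  have h4 := congrArg (LoopClass.comap Φ hS) hε
  rw [map_mul, LoopClass.comap_map, LoopClass.comap_map] at h4
  have h5 : LoopClass.comap Φ hS (LoopClass.mk ε) =
      LoopClass.map s hs.map_base (.mk u) * LoopClass.map i h.map_base (.mk v) := rfl
  rw [h5] at h4
  have h6 := congrArg (LoopClass.map p h.proj_base) h4
  rw [map_mul, map_mul, h.map_proj_map_section hs, h.map_proj_map_section hs,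
    h.map_proj_map_incl, h.map_proj_map_incl, mul_one, mul_one] at h6
  rw [h6, mul_left_cancel_iff] at h4
  have h7 := h.map_incl_injective hs d hd _ h4
  obtain ⟨G⟩ : (β.comap Φ hS).1.HomotopicRel u.1 _ := LoopClass.mk_eq.1 h6.symm
  obtain ⟨K⟩ : (φ.comap Φ hS).1.HomotopicRel v.1 _ := LoopClass.mk_eq.1 h7.symm
  exact ⟨⟨⟨(ContinuousMap.prodMk G.toContinuousMap K.toContinuousMap),
    fun x => Prod.ext (G.apply_zero x) (K.apply_zero x),
    fun x => Prod.ext (G.apply_one x) (K.apply_one x)⟩,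
    fun t x hx => Prod.ext (G.eq_fst t hx) (K.eq_fst t hx)⟩⟩

end IsFibrationSequence

/-! ### Homotopy extension for cubes -/

theorem continuousOn_ite_of_isClosed {A X : Type*} [TopologicalSpace A] [TopologicalSpace X]
    {P Q : A → Prop} [DecidablePred P] (hP : IsClosed {a | P a}) (hQ : IsClosed {a | Q a})
    {f g : A → X} (hf : ContinuousOn f {a | P a}) (hg : ContinuousOn g {a | Q a})
    (hfg : ∀ a, P a → Q a → f a = g a) :
    ContinuousOn (fun a => if P a then f a else g a) {a | P a ∨ Q a} := by
  have h1 : ContinuousOn (fun a => if P a then f a else g a) {a | P a} :=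
    hf.congr fun a (ha : P a) => if_pos ha
  have h2 : ContinuousOn (fun a => if P a then f a else g a) {a | Q a} := by
    refine hg.congr fun a (ha : Q a) => ?_
    by_cases hp : P a
    · simp [hp, hfg a hp ha]
    · simp [hp]
  exact h1.union_of_isClosed h2 hP hQ

namespace Cube

variable {ι : Type*} [Fintype ι]

/-- The distance from the centre of the cube, normalized to be `1` on the boundary. -/
def radius (z : ι → I) : ℝ := ‖fun j => 2 * (z j : ℝ) - 1‖

@[fun_prop]
theorem continuous_radius : Continuous (radius : (ι → I) → ℝ) := by
  unfold radius
  fun_prop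

theorem radius_le_one (z : ι → I) : radius z ≤ 1 := by
  refine (pi_norm_le_iff_of_nonneg zero_le_one).2 fun j => ?_
  rw [Real.norm_eq_abs, abs_le]
  constructor <;> linarith [(z j).2.1, (z j).2.2]

theorem radius_of_mem_boundary {z : ι → I} (hz : z ∈ Cube.boundary ι) : radius z = 1 := by
  obtain ⟨j, hj⟩ := hz
  refine le_antisymm (radius_le_one z) ?_
  have h := norm_le_pi_norm (fun j => 2 * (z j : ℝ) - 1) j
  rcases hj with hj | hj
  · simpa [radius, hj] using h
  · rw [hj] at h
    norm_num at h
    exact h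

/-- The map of the cube that expands the concentric cube of half the side length over the cube
and projects the rest radially to the boundary. -/
def expand (z : ι → I) : ι → I := fun j =>
  Whitehead.clamp (1 / 2 + (2 * (z j : ℝ) - 1) / (2 * max (radius z) (1 / 2)))

theorem max_radius_pos (z : ι → I) : 0 < max (radius z) (1 / 2) :=
  lt_max_of_lt_right (by norm_num)

@[fun_prop]
theorem continuous_expand : Continuous (expand : (ι → I) → ι → I) := by
  refine continuous_pi fun j => ?_
  refine Whitehead.continuous_clamp.comp (continuous_const.add (Continuous.div (by fun_prop)
    (by fun_prop) fun z => ?_))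
  have := max_radius_pos z
  positivity

theorem expand_mem_boundary {z : ι → I} (hz : 1 / 2 ≤ radius z) :
    expand z ∈ Cube.boundary ι := by
  by_contra hb
  have hm : max (radius z) (1 / 2) = radius z := max_eq_left hz
  have hpos : 0 < radius z := by linarith
  refine lt_irrefl (radius z) ((pi_norm_lt_iff hpos).2 fun j => ?_)
  have h0 : ¬ (expand z j = 0 ∨ expand z j = 1) := fun h => hb ⟨j, h⟩
  rw [not_or] at h0
  rw [Real.norm_eq_abs, abs_lt]
  constructor
  · by_contra! hlt
    refine h0.1 (Whitehead.clamp_of_nonpos ?_)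
    rw [hm]
    have : (2 * (z j : ℝ) - 1) / (2 * radius z) ≤ -1 / 2 := by
      rw [div_le_iff₀ (by positivity)]; linarith
    linarith
  · by_contra! hlt
    refine h0.2 (Whitehead.clamp_of_one_le ?_)
    rw [hm]
    have : 1 / 2 ≤ (2 * (z j : ℝ) - 1) / (2 * radius z) := by
      rw [le_div_iff₀ (by positivity)]; linarith
    linarith

theorem expand_of_mem_boundary {z : ι → I} (hz : z ∈ Cube.boundary ι) : expand z = z := by
  funext j
  have h : (1 / 2 + (2 * (z j : ℝ) - 1) / (2 * max (radius z) (1 / 2))) = z j := by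
    rw [radius_of_mem_boundary hz, max_eq_left (by norm_num)]
    ring
  rw [expand, h]
  exact Set.projIcc_val _ _

/-- The homotopy extension property of the pair `(I^ι, ∂I^ι)`. -/
theorem exists_extension {X : Type*} [TopologicalSpace X] {h : (ι → I) × I → X}
    (hc : ContinuousOn h {q | q.1 ∈ Cube.boundary ι}) (G : C(ι → I, X))
    (hG : ∀ z ∈ Cube.boundary ι, G z = h (z, 1)) :
    ∃ M : C(ι → I, X), ∀ z ∈ Cube.boundary ι, M z = h (z, 0) := by
  -- The inner cube carries `G`; the shell of radius between `1 / 2` and `1` carries the homotopy,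
  -- run from time `1` to time `0`.
  refine ⟨⟨fun z => if radius z ≤ 1 / 2 then G (expand z)
    else h (expand z, Whitehead.clamp (2 - 2 * radius z)), ?_⟩, fun z hz => ?_⟩
  · refine continuous_if_le continuous_radius continuous_const (by fun_prop) ?_ ?_
    · refine hc.comp (by fun_prop) fun z hz => ?_
      exact expand_mem_boundary hz
    · intro z hz
      rw [hG _ (expand_mem_boundary hz.ge), Whitehead.clamp_of_one_le]
      rw [hz]
      norm_num
  · change (if radius z ≤ 1 / 2 then _ else _) = _
    rw [radius_of_mem_boundary hz, if_neg (by norm_num), expand_of_mem_boundary hz,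
      Whitehead.clamp_of_nonpos (by norm_num)]

/-- The boundary of a product of two cubes. -/
def prodBoundary (ι κ : Type*) : Set ((ι → I) × (κ → I)) :=
  {z | z.1 ∈ Cube.boundary ι ∨ z.2 ∈ Cube.boundary κ}

/-- The homotopy extension property of a product of two cubes and its boundary. -/
theorem exists_extension_prod {κ : Type*} [Fintype κ] {X : Type*} [TopologicalSpace X]
    {h : ((ι → I) × (κ → I)) × I → X} (hc : ContinuousOn h {q | q.1 ∈ prodBoundary ι κ})
    (G : C((ι → I) × (κ → I), X)) (hG : ∀ z ∈ prodBoundary ι κ, G z = h (z, 1)) :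
    ∃ M : C((ι → I) × (κ → I), X), ∀ z ∈ prodBoundary ι κ, M z = h (z, 0) := by
  let r : C(ι ⊕ κ → I, (ι → I) × (κ → I)) := ⟨fun z => (z ∘ Sum.inl, z ∘ Sum.inr), by
    refine .prodMk ?_ ?_ <;> exact continuous_pi fun j => continuous_apply _⟩
  have hr : ∀ z, z ∈ Cube.boundary (ι ⊕ κ) ↔ r z ∈ prodBoundary ι κ := fun z =>
    Cube.boundary_sum_iff
  obtain ⟨M, hM⟩ := exists_extension (h := fun q => h (r q.1, q.2))
    (hc.comp (by fun_prop) fun q hq => (hr q.1).1 hq) (G.comp r) fun z hz => hG _ ((hr z).1 hz)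
  have hs : Continuous fun z : (ι → I) × (κ → I) => (Sum.elim z.1 z.2 : ι ⊕ κ → I) := by
    refine continuous_pi fun j => ?_
    rcases j with j | j
    · exact (continuous_apply j).comp continuous_fst
    · exact (continuous_apply j).comp continuous_snd
  exact ⟨M.comp ⟨_, hs⟩, fun z hz => hM _ ((hr _).2 hz)⟩

/-- If `h ∘ ρ₁` extends from the boundary over the product of cubes, so does `h ∘ ρ₀`. -/
theorem exists_extension_of_deformation {κ : Type*} [Fintype κ] {X : Type*} [TopologicalSpace X]
    {h : (ι → I) × (κ → I) → X} (hc : ContinuousOn h (prodBoundary ι κ))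
    (ρ : C(((ι → I) × (κ → I)) × I, (ι → I) × (κ → I)))
    (hρ : ∀ z ∈ prodBoundary ι κ, ∀ t, ρ (z, t) ∈ prodBoundary ι κ)
    (hex : ∃ G : C((ι → I) × (κ → I), X), ∀ z ∈ prodBoundary ι κ, G z = h (ρ (z, 1))) :
    ∃ G : C((ι → I) × (κ → I), X), ∀ z ∈ prodBoundary ι κ, G z = h (ρ (z, 0)) := by
  obtain ⟨G, hG⟩ := hex
  exact exists_extension_prod (h := fun q => h (ρ q))
    (hc.comp ρ.continuous.continuousOn fun q hq => hρ q.1 hq q.2) G hG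

end Cube

/-! ### The Whitehead product as an obstruction -/

namespace Whitehead

open Classical in
/-- The map `f ∪ g` on the boundary of the product of cubes. -/
def unionMap {a b : ℕ} {X : Type*} [TopologicalSpace X] {x : X}
    (f : Ω^ (Fin a) X x) (g : Ω^ (Fin b) X x) (z : (Fin a → I) × (Fin b → I)) : X :=
  if z.1 ∈ Cube.boundary (Fin a) then g z.2 else f z.1

section

variable {a b : ℕ} {X : Type*} [TopologicalSpace X] {x : X}
    {f : Ω^ (Fin a) X x} {g : Ω^ (Fin b) X x}

theorem unionMap_of_left {z : (Fin a → I) × (Fin b → I)} (h : z.1 ∈ Cube.boundary (Fin a)) :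
    unionMap f g z = g z.2 := if_pos h

theorem unionMap_of_right {z : (Fin a → I) × (Fin b → I)} (h : z.2 ∈ Cube.boundary (Fin b)) :
    unionMap f g z = f z.1 := by
  by_cases h' : z.1 ∈ Cube.boundary (Fin a)
  · exact (unionMap_of_left h').trans ((g.2 _ h).trans (f.2 _ h').symm)
  · exact if_neg h'

theorem continuousOn_unionMap :
    ContinuousOn (unionMap f g) (Cube.prodBoundary (Fin a) (Fin b)) := by
  classical
  exact continuousOn_ite_of_isClosed (P := fun z : (Fin a → I) × (Fin b → I) =>
      z.1 ∈ Cube.boundary (Fin a)) (Q := fun z => z.2 ∈ Cube.boundary (Fin b))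
    ((Cube.isClosed_boundary a).preimage continuous_fst)
    ((Cube.isClosed_boundary b).preimage continuous_snd)
    (g.1.continuous.comp continuous_snd).continuousOn
    (f.1.continuous.comp continuous_fst).continuousOn
    fun z h1 h2 => (g.2 _ h2).trans (f.2 _ h1).symm

end

/-- The map `f ∪ g` extends over the product of cubes. -/
def HasExtension {a b : ℕ} {X : Type*} [TopologicalSpace X] {x : X}
    (f : Ω^ (Fin a) X x) (g : Ω^ (Fin b) X x) : Prop :=
  ∃ M : C((Fin a → I) × (Fin b → I), X),
    ∀ z ∈ Cube.prodBoundary (Fin a) (Fin b), M z = unionMap f g z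

/-- Membership in the two boundaries would not survive the scaling of the first coordinates in the
contraction below; their vanishing does. -/
theorem coord_zero_of_boundary (a b : ℕ) {u : Fin (a + b + 1) → I}
    (hu : u ∈ Cube.boundary (Fin (a + b + 1))) : leftCoord a b u 0 = 0 ∧ rightCoord a b u 0 = 0 := by
  suffices h : collar (Fin.tail u) = 0 ∨ (edge₁ (u 0) = 0 ∧ edge₂ (u 0) = 0) by
    rcases h with h | ⟨h, h'⟩
    · simp [leftCoord, rightCoord, h]
    · simp [leftCoord, rightCoord, h, h']
  obtain ⟨j, hj⟩ := hu
  revert hj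
  refine Fin.cases (fun hj => ?_) (fun j hj => ?_) j
  · right
    rcases hj with hj | hj
    · exact ⟨clamp_of_nonpos ((min_le_left _ _).trans (by simp [hj])),
        clamp_of_nonpos ((min_le_left _ _).trans (by simp [hj]))⟩
    · exact ⟨clamp_of_nonpos ((min_le_right _ _).trans (by rw [hj]; norm_num)),
        clamp_of_nonpos ((min_le_right _ _).trans (by rw [hj]; norm_num))⟩
  · left
    refine Finset.prod_eq_zero (Finset.mem_univ j) ?_
    rcases hj with hj | hj
    · exact clamp_of_nonpos ((min_le_left _ _).trans (by simp [Fin.tail, hj]))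
    · exact clamp_of_nonpos ((min_le_right _ _).trans (by simp [Fin.tail, hj]))

variable {a b : ℕ} {X : Type*} [TopologicalSpace X] {x : X}
  {f : Ω^ (Fin (a + 1)) X x} {g : Ω^ (Fin (b + 1)) X x}

/-- Scaling both first coordinates to `0` moves the parametrized sphere through the product of cubes
to points with both components in the boundary, where `M` is `x`. Points coming from the boundary of
the parametrizing cube have both first coordinates `0` throughout. -/
theorem HasExtension.genLoop_homotopic_const (h : HasExtension f g) :
    GenLoop.Homotopic (genLoop f g) GenLoop.const := by
  obtain ⟨M, hM⟩ := h
  let c (n : ℕ) (q : I × (Fin (n + 1) → I)) : Fin (n + 1) → I :=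
    Fin.cons (σ q.1 * q.2 0) (Fin.tail q.2)
  have hc : ∀ n, Continuous (c n) := fun n => by
    refine continuous_pi fun j => ?_
    refine Fin.cases ?_ (fun j => ?_) j
    · simp only [c, Fin.cons_zero]; fun_prop
    · simp only [c, Fin.cons_succ, Fin.tail]; fun_prop
  have hc0 : ∀ n t (y : Fin (n + 1) → I), t = 1 ∨ y 0 = 0 →
      c n (t, y) ∈ Cube.boundary (Fin (n + 1)) := fun n t y h => by
    refine ⟨0, Or.inl ?_⟩
    rcases h with h | h <;> simp [c, h]
  have hMx : ∀ y z, y ∈ Cube.boundary (Fin (a + 1)) → z ∈ Cube.boundary (Fin (b + 1)) →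
      M (y, z) = x := fun y z hy hz => by
    rw [hM _ (Or.inl hy), unionMap_of_left hy]
    exact g.2 _ hz
  have hu0 : ∀ u ∈ Cube.boundary (Fin (a + b + 1)), genLoop f g u = x := (genLoop f g).2
  refine ⟨⟨⟨⟨fun q => M (c a (q.1, leftCoord a b q.2), c b (q.1, rightCoord a b q.2)), ?_⟩,
    fun u => ?_, fun u => ?_⟩, fun t u hu => ?_⟩⟩
  · have h1 := hc a
    have h2 := hc b
    fun_prop
  · have h : ∀ n (y : Fin (n + 1) → I), c n (0, y) = y := fun n y => by
      simp [c]
    change M (c a (0, _), c b (0, _)) = _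
    rw [h, h, hM _ (coord_mem a b u)]
    rfl
  · exact hMx _ _ (hc0 _ _ _ (Or.inl rfl)) (hc0 _ _ _ (Or.inl rfl))
  · have h := coord_zero_of_boundary a b hu
    exact (hMx _ _ (hc0 _ _ _ (Or.inr h.1)) (hc0 _ _ _ (Or.inr h.2))).trans (hu0 u hu).symm

end Whitehead

/-! ### From a vanishing Whitehead product to an extension over the product of cubes -/

namespace Whitehead

theorem stretch_of_mem {r : I} (h : r = 0 ∨ r = 1) : stretch r = r := by
  rcases h with rfl | rfl
  · exact clamp_of_nonpos (by norm_num)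
  · exact clamp_of_one_le (by norm_num)

theorem clamp_coe (r : I) : clamp r = r := Set.projIcc_val _ _

/-- The convex combination `(1 - t) r + t r'`. -/
def mix (t r r' : I) : I := clamp ((1 - (t : ℝ)) * r + t * r')

@[fun_prop]
theorem continuous_mix {A : Type*} [TopologicalSpace A] {t r r' : A → I} (ht : Continuous t)
    (hr : Continuous r) (hr' : Continuous r') : Continuous fun a => mix (t a) (r a) (r' a) := by
  unfold mix
  fun_prop

theorem mix_zero (r r' : I) : mix 0 r r' = r := by simp [mix, clamp_coe]

theorem mix_one (r r' : I) : mix 1 r r' = r' := by simp [mix, clamp_coe]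

theorem mix_self (t r : I) : mix t r r = r := by
  rw [mix, show (1 - (t : ℝ)) * r + t * r = r by ring, clamp_coe]

/-- The edge parametrization is a left inverse of `τ = (v₁ + v₂) / 4` on the lower right half of
the boundary of the square. -/
theorem edge_lower {r r' : I} (h : r' = 0 ∨ r = 1) :
    edge₁ (clamp ((r + r' : ℝ) / 4)) = r ∧ edge₂ (clamp ((r + r' : ℝ) / 4)) = r' := by
  have h1 := r.2.1
  have h2 := r.2.2
  have h3 := r'.2.1
  have h4 := r'.2.2
  have hc : ((clamp ((r + r' : ℝ) / 4) : I) : ℝ) = (r + r') / 4 := by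
    rw [clamp, Set.coe_projIcc, min_eq_right (by linarith), max_eq_right (by linarith)]
  rw [edge₁, edge₂, hc]
  rcases h with rfl | rfl
  · constructor
    · rw [min_eq_left (by simp; linarith)]
      simp [mul_div_cancel₀, clamp_coe]
    · exact clamp_of_nonpos ((min_le_left _ _).trans (by simp; linarith))
  · constructor
    · exact clamp_of_one_le (le_min (by simp; linarith) (by simp; linarith))
    · rw [min_eq_left (by simp; linarith), show 4 * ((((1 : I) : ℝ) + r') / 4) - 1 = r' by rw [Set.Icc.coe_one]; ring,
        clamp_coe]

/-- On the return half of the circuit the two coordinates add up to `4 (1 - τ)`, which determines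
`τ`. -/
theorem edge_upper {r r' : I} (h : r = 0 ∨ r' = 1) :
    edge₁ (clamp (1 - (r + r' : ℝ) / 4)) = r ∧ edge₂ (clamp (1 - (r + r' : ℝ) / 4)) = r' := by
  have h1 := r.2.1
  have h2 := r.2.2
  have h3 := r'.2.1
  have h4 := r'.2.2
  have hc : ((clamp (1 - (r + r' : ℝ) / 4) : I) : ℝ) = 1 - (r + r') / 4 := by
    rw [clamp, Set.coe_projIcc, min_eq_right (by linarith), max_eq_right (by linarith)]
  rw [edge₁, edge₂, hc]
  rcases h with rfl | rfl
  · constructor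
    · exact clamp_of_nonpos ((min_le_right _ _).trans (by simp; linarith))
    · rw [min_eq_right (by simp; linarith),
        show 4 - 4 * (1 - (((0 : I) : ℝ) + r') / 4) = r' by simp; ring, clamp_coe]
  · constructor
    · rw [min_eq_right (by simp; linarith),
        show 3 - 4 * (1 - ((r : ℝ) + ((1 : I) : ℝ)) / 4) = r by simp; ring, clamp_coe]
    · exact clamp_of_one_le (le_min (by simp; linarith) (by simp; linarith))

variable {a b : ℕ}

/-- The last `a + b` coordinates of a point of the product of cubes. -/
def tails (z : (Fin (a + 1) → I) × (Fin (b + 1) → I)) : Fin (a + b) → I :=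
  Fin.append (Fin.tail z.1) (Fin.tail z.2)

@[fun_prop]
theorem continuous_tails :
    Continuous (tails : (Fin (a + 1) → I) × (Fin (b + 1) → I) → Fin (a + b) → I) := by
  refine continuous_pi fun j => ?_
  refine Fin.addCases (fun j => ?_) (fun j => ?_) j
  · simp only [tails, Fin.append_left, Fin.tail]; fun_prop
  · simp only [tails, Fin.append_right, Fin.tail]; fun_prop

theorem mem_boundary_of_tails {z : (Fin (a + 1) → I) × (Fin (b + 1) → I)} {j : Fin (a + b)}
    (h : tails z j = 0 ∨ tails z j = 1) : z ∈ Cube.prodBoundary (Fin (a + 1)) (Fin (b + 1)) := by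
  revert h
  refine Fin.addCases (fun j h => ?_) (fun j h => ?_) j
  · exact Or.inl ⟨j.succ, by simpa [tails, Fin.tail] using h⟩
  · exact Or.inr ⟨j.succ, by simpa [tails, Fin.tail] using h⟩

theorem mem_prodBoundary_iff {z : (Fin (a + 1) → I) × (Fin (b + 1) → I)} :
    z ∈ Cube.prodBoundary (Fin (a + 1)) (Fin (b + 1)) ↔
      (z.2 0 = 0 ∨ z.1 0 = 1) ∨ (z.1 0 = 0 ∨ z.2 0 = 1) ∨
        tails z ∈ Cube.boundary (Fin (a + b)) := by
  constructor
  · rintro (⟨j, hj⟩ | ⟨j, hj⟩)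
    · revert hj
      refine Fin.cases (fun hj => ?_) (fun j hj => ?_) j
      · tauto
      · exact Or.inr (Or.inr ⟨Fin.castAdd b j, by simpa [tails, Fin.tail] using hj⟩)
    · revert hj
      refine Fin.cases (fun hj => ?_) (fun j hj => ?_) j
      · tauto
      · exact Or.inr (Or.inr ⟨Fin.natAdd a j, by simpa [tails, Fin.tail] using hj⟩)
  · rintro ((h | h) | (h | h) | ⟨j, hj⟩)
    · exact Or.inr ⟨0, Or.inl h⟩
    · exact Or.inl ⟨0, Or.inr h⟩
    · exact Or.inl ⟨0, Or.inl h⟩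
    · exact Or.inr ⟨0, Or.inr h⟩
    · exact mem_boundary_of_tails hj

theorem collar_eq_zero {n : ℕ} {w : Fin n → I} (hw : w ∈ Cube.boundary (Fin n)) :
    collar w = 0 := by
  obtain ⟨j, hj⟩ := hw
  refine Finset.prod_eq_zero (Finset.mem_univ j) ?_
  rcases hj with hj | hj
  · exact clamp_of_nonpos ((min_le_left _ _).trans (by simp [hj]))
  · exact clamp_of_nonpos ((min_le_right _ _).trans (by simp [hj]))

@[fun_prop]
theorem continuous_collar (n : ℕ) : Continuous (collar : (Fin n → I) → I) := by
  unfold collar tent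
  fun_prop

/-- Stretching the last `a + b` coordinates. -/
def stretchHomotopy (a b : ℕ) : C(((Fin (a + 1) → I) × (Fin (b + 1) → I)) × I,
    (Fin (a + 1) → I) × (Fin (b + 1) → I)) where
  toFun q :=
    (Fin.cons (q.1.1 0) fun j => mix q.2 (q.1.1 j.succ) (stretch (q.1.1 j.succ)),
      Fin.cons (q.1.2 0) fun j => mix q.2 (q.1.2 j.succ) (stretch (q.1.2 j.succ)))
  continuous_toFun := by
    refine .prodMk ?_ ?_ <;>
    · refine continuous_pi fun j => ?_
      refine Fin.cases ?_ (fun j => ?_) j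
      · simp only [Fin.cons_zero]; fun_prop
      · simp only [Fin.cons_succ, stretch]; fun_prop

/-- Contracting the boundary of the square of the first coordinates to a corner where the
remaining coordinates are in the collar. -/
def collarHomotopy (a b : ℕ) : C(((Fin (a + 1) → I) × (Fin (b + 1) → I)) × I,
    (Fin (a + 1) → I) × (Fin (b + 1) → I)) where
  toFun q :=
    (Fin.cons (mix q.2 1 (collar (tails q.1)) * q.1.1 0) fun j => stretch (q.1.1 j.succ),
      Fin.cons (mix q.2 1 (collar (tails q.1)) * q.1.2 0) fun j => stretch (q.1.2 j.succ))
  continuous_toFun := by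
    refine .prodMk ?_ ?_ <;>
    · refine continuous_pi fun j => ?_
      refine Fin.cases ?_ (fun j => ?_) j
      · simp only [Fin.cons_zero]; fun_prop
      · simp only [Fin.cons_succ, stretch]; fun_prop

/-- `stretch` fixes `0` and `1`, so a coordinate with one of these values keeps it. -/
theorem stretchHomotopy_mem {z : (Fin (a + 1) → I) × (Fin (b + 1) → I)}
    (hz : z ∈ Cube.prodBoundary (Fin (a + 1)) (Fin (b + 1))) (t : I) :
    stretchHomotopy a b (z, t) ∈ Cube.prodBoundary (Fin (a + 1)) (Fin (b + 1)) := by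
  have key : ∀ (n : ℕ) (y : Fin (n + 1) → I), y ∈ Cube.boundary (Fin (n + 1)) →
      (Fin.cons (y 0) fun j => mix t (y j.succ) (stretch (y j.succ)) : Fin (n + 1) → I) ∈
        Cube.boundary (Fin (n + 1)) := by
    rintro n y ⟨j, hj⟩
    refine ⟨j, ?_⟩
    revert hj
    refine Fin.cases (fun hj => ?_) (fun j hj => ?_) j
    · simpa using hj
    · simpa [stretch_of_mem hj, mix_self] using hj
  exact hz.imp (key a z.1) (key b z.2)

/-- If every tent function is `1`, the scaling factor is `1` at all times and the first coordinates
do not move. Otherwise some other coordinate has been stretched to `0` or `1`, and the first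
coordinates do not matter. -/
theorem collarHomotopy_mem {z : (Fin (a + 1) → I) × (Fin (b + 1) → I)}
    (hz : z ∈ Cube.prodBoundary (Fin (a + 1)) (Fin (b + 1))) (t : I) :
    collarHomotopy a b (z, t) ∈ Cube.prodBoundary (Fin (a + 1)) (Fin (b + 1)) := by
  have htl : ∀ j, tails (collarHomotopy a b (z, t)) j = stretch (tails z j) := fun j => by
    refine Fin.addCases (fun j => ?_) (fun j => ?_) j <;> simp [tails, collarHomotopy, Fin.tail]
  by_cases h : ∀ j, tent (tails z j) = 1
  · have hc : collar (tails z) = 1 := Finset.prod_eq_one fun j _ => h j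
    rcases mem_prodBoundary_iff.1 hz with h' | h' | ⟨j, hj⟩
    · refine mem_prodBoundary_iff.2 (Or.inl ?_)
      simpa [collarHomotopy, hc, mix_self] using h'
    · refine mem_prodBoundary_iff.2 (Or.inr (Or.inl ?_))
      simpa [collarHomotopy, hc, mix_self] using h'
    · exact mem_boundary_of_tails (j := j) (by rw [htl, stretch_of_mem hj]; exact hj)
  · push Not at h
    obtain ⟨j, hj⟩ := h
    exact mem_boundary_of_tails (j := j)
      (by rw [htl]; exact (tent_or_stretch (tails z j)).resolve_left hj)

variable {X : Type*} [TopologicalSpace X] {x : X}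
  {f : Ω^ (Fin (a + 1)) X x} {g : Ω^ (Fin (b + 1)) X x}

/-- The parametrization is not injective, but where the first coordinates lie on the boundary of the
square, `z ↦ (τ, tails z)` is a section of it up to deformation: the composite is the end of
`collarHomotopy`. -/
theorem leftCoord_cons_tails (τ : I) (z : (Fin (a + 1) → I) × (Fin (b + 1) → I))
    (h1 : edge₁ τ = z.1 0) (h2 : edge₂ τ = z.2 0) :
    (leftCoord a b (Fin.cons τ (tails z)), rightCoord a b (Fin.cons τ (tails z))) =
      collarHomotopy a b (z, 1) := by
  simp [leftCoord, rightCoord, collarHomotopy, h1, h2, mix_one, tails, Fin.tail]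

/-- If the Whitehead product of `f` and `g` vanishes, then `f ∪ g` extends over the product of
cubes. -/
theorem hasExtension_of_genLoop_homotopic_const
    (h : GenLoop.Homotopic (genLoop f g) GenLoop.const) : HasExtension f g := by
  classical
  obtain ⟨N⟩ := h
  have hN : ∀ t, ∀ u ∈ Cube.boundary (Fin (a + b + 1)), N (t, u) = x := fun t u hu =>
    (N.eq_fst t hu).trans ((genLoop f g).2 u hu)
  have hN' : ∀ t τ (z : (Fin (a + 1) → I) × (Fin (b + 1) → I)),
      tails z ∈ Cube.boundary (Fin (a + b)) → N (t, Fin.cons τ (tails z)) = x := by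
    rintro t τ z ⟨j, hj⟩
    exact hN t _ ⟨j.succ, by simpa using hj⟩
  have hN0 : ∀ t τ (z : (Fin (a + 1) → I) × (Fin (b + 1) → I)), τ = 0 ∨ τ = 1 →
      N (t, Fin.cons τ (tails z)) = x := fun t τ z hτ => hN t _ ⟨0, by simpa using hτ⟩
  have step1 : ∃ G : C((Fin (a + 1) → I) × (Fin (b + 1) → I), X),
      ∀ z ∈ Cube.prodBoundary (Fin (a + 1)) (Fin (b + 1)),
        G z = unionMap f g (collarHomotopy a b (z, 1)) := by
    -- The null homotopy `N` transported to the boundary of the product, using the coordinate `τ` on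
    -- each half of the boundary of the square. Boundary points outside both halves have their tails
    -- in the boundary of the cube, where `N` is `x`.
    let K : ((Fin (a + 1) → I) × (Fin (b + 1) → I)) × I → X := fun q =>
      if q.1.2 0 = 0 ∨ q.1.1 0 = 1 then
        N (q.2, Fin.cons (clamp ((q.1.1 0 + q.1.2 0 : ℝ) / 4)) (tails q.1))
      else if q.1.1 0 = 0 ∨ q.1.2 0 = 1 then
        N (q.2, Fin.cons (clamp (1 - (q.1.1 0 + q.1.2 0 : ℝ) / 4)) (tails q.1))
      else x
    have c0 : ∀ {u : ((Fin (a + 1) → I) × (Fin (b + 1) → I)) × I → I}, Continuous u →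
        Continuous fun q : ((Fin (a + 1) → I) × (Fin (b + 1) → I)) × I =>
          N (q.2, Fin.cons (u q) (tails q.1)) := by
      intro u hu
      refine N.continuous.comp (continuous_snd.prodMk (continuous_pi fun j => ?_))
      refine Fin.cases ?_ (fun j => ?_) j
      · simpa only [Fin.cons_zero] using hu
      · simp only [Fin.cons_succ]; fun_prop
    have cl : ∀ (u v : ((Fin (a + 1) → I) × (Fin (b + 1) → I)) × I → I) (c d : I),
        Continuous u → Continuous v → IsClosed {q | u q = c ∨ v q = d} := fun u v c d hu hv =>
      (isClosed_eq hu continuous_const).union (isClosed_eq hv continuous_const)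
    have hK : ContinuousOn K {q | q.1 ∈ Cube.prodBoundary (Fin (a + 1)) (Fin (b + 1))} := by
      simp only [mem_prodBoundary_iff]
      have ct : IsClosed {q : ((Fin (a + 1) → I) × (Fin (b + 1) → I)) × I |
          tails q.1 ∈ Cube.boundary (Fin (a + b))} :=
        (Cube.isClosed_boundary _).preimage (continuous_tails.comp continuous_fst)
      refine continuousOn_ite_of_isClosed (cl _ _ _ _ (by fun_prop) (by fun_prop))
        ((cl _ _ _ _ (by fun_prop) (by fun_prop)).union ct) (c0 (by fun_prop)).continuousOn
        (continuousOn_ite_of_isClosed (cl _ _ _ _ (by fun_prop) (by fun_prop)) ct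
          (c0 (by fun_prop)).continuousOn continuousOn_const
          fun q _ h2 => hN' _ _ _ h2) fun q h1 h2 => ?_
      by_cases h3 : q.1.1 0 = 0 ∨ q.1.2 0 = 1
      · rw [if_pos h3]
        -- The halves meet at the corner `(0, 0)`, where `τ` is `0` or `1` and `N` is `x`, and at
        -- `(1, 1)`, where both formulas give `τ = 1 / 2`.
        rcases h1 with h1 | h1 <;> rcases h3 with h3 | h3
        · rw [hN0 _ _ _ (Or.inl (clamp_of_nonpos (by simp [h1, h3]))),
            hN0 _ _ _ (Or.inr (clamp_of_one_le (by simp [h1, h3])))]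
        · exact absurd (h1.symm.trans h3) zero_ne_one
        · exact absurd (h3.symm.trans h1) zero_ne_one
        · rw [h1, h3]
          norm_num
      · rw [if_neg h3]
        exact hN' _ _ _ (h2.resolve_left h3)
    obtain ⟨G, hG⟩ := Cube.exists_extension_prod hK (.const _ x) (by
      intro z hz
      simp only [K]
      split_ifs
      · exact (N.apply_one _).symm
      · exact (N.apply_one _).symm
      · rfl)
    refine ⟨G, fun z hz => (hG z hz).trans ?_⟩
    simp only [K]
    split_ifs with h1 h2
    · rw [N.apply_zero, ← leftCoord_cons_tails _ z (edge_lower h1).1 (edge_lower h1).2]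
      rfl
    · rw [N.apply_zero, ← leftCoord_cons_tails _ z (edge_upper h2).1 (edge_upper h2).2]
      rfl
    · have h3 := (mem_prodBoundary_iff.1 hz).resolve_left h1 |>.resolve_left h2
      have h4 : (collarHomotopy a b (z, 1)).1 ∈ Cube.boundary (Fin (a + 1)) :=
        ⟨0, Or.inl (by simp [collarHomotopy, mix_one, collar_eq_zero h3])⟩
      rw [unionMap_of_left h4]
      exact (g.2 _ ⟨0, Or.inl (by simp [collarHomotopy, mix_one, collar_eq_zero h3])⟩).symm
  -- The deformations are undone: `collarHomotopy` back to time `0`, where it agrees with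
  -- `stretchHomotopy` at time `1`, and the latter back to the identity.
  have step2 := Cube.exists_extension_of_deformation continuousOn_unionMap _
    (fun z hz t => collarHomotopy_mem hz t) step1
  have h01 : ∀ z, collarHomotopy a b (z, 0) = stretchHomotopy a b (z, 1) := fun z => by
    simp [collarHomotopy, stretchHomotopy, mix_zero, mix_one]
  simp only [h01] at step2
  obtain ⟨G, hG⟩ := Cube.exists_extension_of_deformation continuousOn_unionMap _
    (fun z hz t => stretchHomotopy_mem hz t) step2
  refine ⟨G, fun z hz => (hG z hz).trans (congrArg _ ?_)⟩
  simp only [stretchHomotopy, ContinuousMap.coe_mk, mix_zero]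
  exact Prod.ext (Fin.cons_self_tail z.1) (Fin.cons_self_tail z.2)

end Whitehead

/-! ### The topology of wedges of spheres -/

/-- A function on the cube that vanishes exactly on the boundary. -/
def Cube.height {n : ℕ} (y : Fin n → I) : I := ∏ j, y j * σ (y j)

theorem Cube.continuous_height (n : ℕ) : Continuous (Cube.height : (Fin n → I) → I) := by
  unfold Cube.height
  fun_prop

theorem Cube.height_eq_zero {n : ℕ} {y : Fin n → I} :
    Cube.height y = 0 ↔ y ∈ Cube.boundary (Fin n) := by
  have h : ∀ r : I, r * σ r = 0 ↔ r = 0 ∨ r = 1 := fun r => by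
    rw [mul_eq_zero, unitInterval.symm_eq_zero]
  simp [Cube.height, Finset.prod_eq_zero_iff, Cube.boundary, h]

namespace CubeSphere

instance (n : ℕ) : CompactSpace (CubeSphere n) := by
  unfold CubeSphere; infer_instance

/-- The map of the cube that collapses exactly the boundary. -/
def collapse {n : ℕ} (y : Fin n → I) : I × (Fin n → I) :=
  (Cube.height y, fun j => Cube.height y * y j)

theorem collapse_of_mem {n : ℕ} {y : Fin n → I} (hy : y ∈ Cube.boundary (Fin n)) :
    collapse y = 0 := by
  have h := Cube.height_eq_zero.2 hy
  refine Prod.ext h (funext fun j => ?_)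
  simp [collapse, h]

/-- An embedding of the sphere into a cube. -/
def coords (n : ℕ) : CubeSphere n → I × (Fin n → I) :=
  Quot.lift collapse fun _ _ h => (collapse_of_mem h.1).trans (collapse_of_mem h.2).symm

theorem continuous_coords (n : ℕ) : Continuous (coords n) := by
  refine continuous_quot_lift _ ?_
  have := Cube.continuous_height n
  unfold collapse
  fun_prop

theorem coords_base (n : ℕ) : coords (n + 1) (base (n + 1)) = 0 :=
  collapse_of_mem ⟨0, Or.inl rfl⟩

/-- Off the boundary the height is nonzero and can be cancelled. -/
theorem coords_injective (n : ℕ) : Function.Injective (coords (n + 1)) := by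
  rintro ⟨y⟩ ⟨z⟩ h
  have h1 : Cube.height y = Cube.height z := congrArg Prod.fst h
  have h2 : ∀ j, Cube.height y * y j = Cube.height z * z j := fun j =>
    congrFun (congrArg Prod.snd h) j
  by_cases hy : Cube.height y = 0
  · exact Quot.sound ⟨Cube.height_eq_zero.1 hy, Cube.height_eq_zero.1 (h1 ▸ hy)⟩
  · refine congrArg _ (funext fun j => mul_left_cancel₀ hy ?_)
    rw [h2 j, h1]

end CubeSphere

namespace SphereWedge

variable {n : ℕ} {d : Fin n → ℕ}

/-- The characteristic map of the `j`-th cell. -/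
def cell (d : Fin n → ℕ) (j : Fin n) : C(Fin (d j) → I, SphereWedge d) :=
  (Wedge.incl _ _ j).comp (CubeSphere.char (d j)).1

theorem cell_of_mem {j : Fin n} {y : Fin (d j) → I} (hy : y ∈ Cube.boundary (Fin (d j))) :
    cell d j y = base d := by
  have h : CubeSphere.char (d j) y = CubeSphere.base (d j) := (CubeSphere.char (d j)).2 y hy
  exact (congrArg (Wedge.incl _ _ j) h).trans (Wedge.incl_base _ _ j)

theorem base_or_cell (w : SphereWedge d) : w = base d ∨ ∃ j y, w = cell d j y := by
  obtain ⟨_ | ⟨j, ⟨y⟩⟩⟩ := w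
  · exact Or.inl rfl
  · exact Or.inr ⟨j, y, rfl⟩

instance : CompactSpace (SphereWedge d) :=
  inferInstanceAs (CompactSpace (Quot fun y z : Unit ⊕ (Σ j, CubeSphere (d j)) =>
    y = Sum.inl () ∧ ∃ j, z = Sum.inr ⟨j, CubeSphere.base (d j)⟩))

/-- An embedding of a wedge of spheres into a cube. -/
def coords (l : Fin n → ℕ) :
    SphereWedge (fun j => l j + 1) → ∀ j, I × (Fin (l j + 1) → I) :=
  Quot.lift (Sum.elim (fun _ => 0) fun y => Pi.single y.1 (CubeSphere.coords _ y.2)) (by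
    rintro y z ⟨rfl, j, rfl⟩
    change 0 = Pi.single (M := fun j => I × (Fin (l j + 1) → I)) j
      (CubeSphere.coords (l j + 1) (CubeSphere.base _))
    rw [CubeSphere.coords_base, Pi.single_zero])

theorem continuous_coords (l : Fin n → ℕ) : Continuous (coords l) := by
  refine continuous_quot_lift _ (continuous_sum_dom.2 ⟨continuous_const, ?_⟩)
  refine continuous_sigma fun j => ?_
  exact (continuous_single j).comp (CubeSphere.continuous_coords _)

/-- Distinct summands go to distinct coordinate factors, which meet only in `0`, the image of the
base point. -/
theorem coords_injective (l : Fin n → ℕ) : Function.Injective (coords l) := by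
  have key : ∀ j (y : CubeSphere (l j + 1)),
      (Pi.single j (CubeSphere.coords _ y) : ∀ j, I × (Fin (l j + 1) → I)) = 0 →
      (Quot.mk _ (Sum.inr ⟨j, y⟩) : SphereWedge fun j => l j + 1) = base _ := fun j y h => by
    rw [Pi.single_eq_zero_iff, ← CubeSphere.coords_base] at h
    rw [CubeSphere.coords_injective _ h]
    exact Wedge.incl_base _ _ j
  rintro ⟨⟨⟩ | ⟨j, y⟩⟩ ⟨⟨⟩ | ⟨j', y'⟩⟩ h
  · rfl
  · exact (key j' y' h.symm).symm
  · exact key j y h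
  · change Pi.single (M := fun j => I × (Fin (l j + 1) → I)) j (CubeSphere.coords _ y) =
      Pi.single (M := fun j => I × (Fin (l j + 1) → I)) j' (CubeSphere.coords _ y') at h
    by_cases hj : j = j'
    · subst hj
      rw [CubeSphere.coords_injective _ (Pi.single_injective j h)]
    · have h1 : CubeSphere.coords _ y = 0 := by
        have := congrFun h j
        rwa [Pi.single_eq_same, Pi.single_eq_of_ne hj] at this
      have h2 : CubeSphere.coords _ y' = 0 := by
        have := congrFun h j'
        rw [Pi.single_eq_same, Pi.single_eq_of_ne (Ne.symm hj)] at this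
        exact this.symm
      exact (key j y (by rw [h1, Pi.single_zero])).trans
        (key j' y' (by rw [h2, Pi.single_zero])).symm

/-- With compactness this gives the local compactness that `continuous_prod` requires of the second
factor. -/
instance (l : Fin n → ℕ) : T2Space (SphereWedge fun j => l j + 1) :=
  T2Space.of_injective_continuous (coords_injective l) (continuous_coords l)

/-- The base point of a wedge of spheres is the zero set of a function. -/
theorem exists_eq_zero_iff_eq_base (l : Fin n → ℕ) :
    ∃ h : C(SphereWedge (fun j => l j + 1), I), ∀ w, h w = 0 ↔ w = base _ := by
  refine ⟨⟨fun w => Whitehead.clamp (dist (coords l w) (coords l (base _))), ?_⟩, fun w => ?_⟩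
  · exact Whitehead.continuous_clamp.comp ((continuous_coords l).dist continuous_const)
  · refine (Set.projIcc_eq_left zero_lt_one).trans ?_
    rw [dist_le_zero, (coords_injective l).eq_iff]

/-- Continuity of maps defined on the product of a wedge of spheres and a locally compact space
can be checked on the cells. -/
theorem continuous_prod {Y Z : Type*} [TopologicalSpace Y] [LocallyCompactSpace Y]
    [TopologicalSpace Z] {g : SphereWedge d × Y → Z} (h0 : Continuous fun y => g (base d, y))
    (hj : ∀ j, Continuous fun q : (Fin (d j) → I) × Y => g (cell d j q.1, q.2)) :
    Continuous g := by
  have hs : ∀ w, Continuous fun y => g (w, y) := fun w => by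
    rcases base_or_cell w with rfl | ⟨j, y, rfl⟩
    · exact h0
    · exact (hj j).comp (continuous_const.prodMk continuous_id)
  -- A product of a quotient map with a space need not be a quotient map. After currying, continuity
  -- is tested on the cells of the wedge alone; local compactness of `Y` permits uncurrying.
  let G : SphereWedge d → C(Y, Z) := fun w => ⟨_, hs w⟩
  have hG : Continuous G := by
    refine isQuotientMap_quot_mk.continuous_iff.2 (continuous_sum_dom.2
      ⟨continuous_of_discreteTopology, ?_⟩)
    refine continuous_sigma fun j => ?_
    refine isQuotientMap_quot_mk.continuous_iff.2 ?_
    exact (ContinuousMap.curry ⟨_, hj j⟩).continuous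
  exact ContinuousMap.continuous_uncurry_of_continuous ⟨G, hG⟩

end SphereWedge

/-! ### Homotopy groups as groups of loop classes -/

namespace GenLoop

variable {n : ℕ} {X : Type*} [TopologicalSpace X] {x : X}

/-- A generalized loop as a family of loops, in the direction of the first coordinate. -/
def toFamily (f : Ω^ (Fin (n + 1)) X x) : LoopFamily (Cube.boundary (Fin n)) x :=
  ⟨⟨fun y => ⟨⟨fun t => f (Fin.cons t y), f.1.continuous.comp (by fun_prop)⟩,
      f.2 _ ⟨0, Or.inl rfl⟩, f.2 _ ⟨0, Or.inr rfl⟩⟩,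
    Path.continuous_uncurry_iff.mp (f.1.continuous.comp
      (g := f.1) (f := fun q : (Fin n → I) × I => (Fin.cons q.2 q.1 : Fin (n + 1) → I))
      (by fun_prop))⟩,
    fun y ⟨j, hj⟩ => by
      ext t
      exact f.2 _ ⟨j.succ, by simpa using hj⟩⟩

theorem toFamily_apply (f : Ω^ (Fin (n + 1)) X x) (y : Fin n → I) (t : I) :
    (toFamily f).1 y t = f (Fin.cons t y) := rfl

theorem toFamily_surjective (a : LoopFamily (Cube.boundary (Fin n)) x) :
    ∃ f : Ω^ (Fin (n + 1)) X x, (toFamily f) = a := by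
  refine ⟨⟨⟨fun u => a.1 (Fin.tail u) (u 0), ?_⟩, ?_⟩, ?_⟩
  · have : Continuous fun u : Fin (n + 1) → I => Fin.tail u := by unfold Fin.tail; fun_prop
    fun_prop
  · rintro u ⟨j, hj⟩
    change a.1 (Fin.tail u) (u 0) = x
    revert hj
    refine Fin.cases (fun hj => ?_) (fun j hj => ?_) j
    · rcases hj with hj | hj
      · rw [hj]; exact (a.1 _).source
      · rw [hj]; exact (a.1 _).target
    · rw [a.2 _ ⟨j, hj⟩]
      rfl
  · refine Subtype.ext (ContinuousMap.ext fun y => ?_)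
    ext t
    change a.1 (Fin.tail (Fin.cons t y : Fin (n + 1) → I)) ((Fin.cons t y : Fin (n + 1) → I) 0) = _
    rw [Fin.tail_cons, Fin.cons_zero]

theorem homotopic_iff {f g : Ω^ (Fin (n + 1)) X x} :
    Homotopic f g ↔ (toFamily f) ≈ (toFamily g) := by
  constructor
  · rintro ⟨H⟩
    have hH : ∀ t, ∀ u ∈ Cube.boundary (Fin (n + 1)), H (t, u) = x := fun t u hu =>
      (H.eq_fst t hu).trans (f.2 u hu)
    refine LoopFamily.equiv_of_path (fun t y => ⟨⟨fun τ => H (t, Fin.cons τ y), by fun_prop⟩,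
      hH _ _ ⟨0, Or.inl rfl⟩, hH _ _ ⟨0, Or.inr rfl⟩⟩) ?_ ?_ ?_ ?_
    · change Continuous fun q : (I × (Fin n → I)) × I =>
        H (q.1.1, (Fin.cons q.2 q.1.2 : Fin (n + 1) → I))
      fun_prop
    · intro y; ext τ; exact H.apply_zero _
    · intro y; ext τ; exact H.apply_one _
    · rintro t y ⟨j, hj⟩
      ext τ
      exact hH _ _ ⟨j.succ, by simpa using hj⟩
  · intro h
    obtain ⟨H⟩ : (toFamily f).1.HomotopicRel (toFamily g).1 _ := h
    have ht : Continuous fun u : Fin (n + 1) → I => Fin.tail u := by unfold Fin.tail; fun_prop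
    refine ⟨⟨⟨⟨fun q => H (q.1, Fin.tail q.2) (q.2 0), ?_⟩, ?_, ?_⟩, ?_⟩⟩
    · exact (H.continuous.comp (continuous_fst.prodMk (ht.comp continuous_snd))).eval
        (by fun_prop)
    · intro u
      change H (0, _) _ = f u
      rw [H.apply_zero, toFamily_apply, Fin.cons_self_tail]
    · intro u
      change H (1, _) _ = g u
      rw [H.apply_one, toFamily_apply, Fin.cons_self_tail]
    · rintro t u ⟨j, hj⟩
      change H (t, Fin.tail u) (u 0) = f u
      refine Eq.trans ?_ (f.2 u ⟨j, hj⟩).symm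
      revert hj
      refine Fin.cases (fun hj => ?_) (fun j hj => ?_) j
      · rcases hj with hj | hj
        · rw [hj]; exact (H (t, _)).source
        · rw [hj]; exact (H (t, _)).target
      · rw [H.eq_fst t ⟨j, hj⟩, (toFamily f).2 _ ⟨j, hj⟩]
        rfl

theorem mk_toFamily_eq {f g : Ω^ (Fin (n + 1)) X x} :
    LoopClass.mk (toFamily f) = LoopClass.mk (toFamily g) ↔ Homotopic f g :=
  Quotient.eq.trans homotopic_iff.symm

end GenLoop

theorem Whitehead.genLoop_mapTo {a b : ℕ} {X Y : Type*} [TopologicalSpace X] [TopologicalSpace Y]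
    {x : X} {y : Y} (p : C(X, Y)) (hp : p x = y) (f : Ω^ (Fin (a + 1)) X x)
    (g : Ω^ (Fin (b + 1)) X x) :
    GenLoop.mapTo p hp (genLoop f g) = genLoop (GenLoop.mapTo p hp f) (GenLoop.mapTo p hp g) :=
  GenLoop.ext _ _ fun u => by
    classical exact apply_ite p (leftCoord a b u ∈ Cube.boundary (Fin (a + 1))) _ _

/-- The James brace product exists and is unique. -/
theorem IsFibrationSequence.existsUnique_isJamesBrace {F : Type*} {E : Type u} {B : Type v}
    [TopologicalSpace F] [TopologicalSpace E] [TopologicalSpace B] {f₀ : F} {e₀ : E} {b₀ : B}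
    {i : C(F, E)} {p : C(E, B)} (h : IsFibrationSequence f₀ e₀ b₀ i p) {s : C(B, E)}
    (hs : IsHomotopySection e₀ b₀ p s) (d : C(B, I)) (hd : ∀ b, d b = 0 ↔ b = b₀) {a b : ℕ}
    (α : π_ (a + 1) B b₀) (β : π_ (b + 1) F f₀) :
    ∃! γ, IsJamesBrace s hs.map_base i h.map_base α β γ := by
  obtain ⟨f, rfl⟩ := Quotient.exists_rep α
  obtain ⟨g, rfl⟩ := Quotient.exists_rep β
  let W := Whitehead.genLoop (GenLoop.mapTo s hs.map_base f) (GenLoop.mapTo i h.map_base g)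
  have hiff : ∀ c : Ω^ (Fin (a + b + 1)) F f₀,
      IsJamesBrace s hs.map_base i h.map_base ⟦f⟧ ⟦g⟧ ⟦c⟧ ↔
        LoopClass.map i h.map_base (LoopClass.mk (GenLoop.toFamily c)) = LoopClass.mk (GenLoop.toFamily W) := fun c =>
    Quotient.eq.trans GenLoop.mk_toFamily_eq.symm
  -- By naturality this is the Whitehead product of `p ∘ s ∘ f` with a constant map, and the union
  -- of these two extends through the projection to the first cube.
  have hW : LoopClass.map p h.proj_base (LoopClass.mk (GenLoop.toFamily W)) = 1 := by
    have h1 : Whitehead.HasExtension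
        (GenLoop.mapTo p h.proj_base (GenLoop.mapTo s hs.map_base f))
        (GenLoop.mapTo p h.proj_base (GenLoop.mapTo i h.map_base g)) := by
      refine ⟨⟨fun z => p (s (f z.1)), by fun_prop⟩, fun z hz => ?_⟩
      rcases hz with hz | hz
      · rw [Whitehead.unionMap_of_left hz]
        exact ((GenLoop.mapTo p h.proj_base (GenLoop.mapTo s hs.map_base f)).2 _ hz).trans
          (h.comp_const _).symm
      · rw [Whitehead.unionMap_of_right hz]
        rfl
    have h2 := h1.genLoop_homotopic_const
    rw [← Whitehead.genLoop_mapTo] at h2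
    exact GenLoop.mk_toFamily_eq.2 h2
  obtain ⟨⟨c⟩, hc⟩ := h.exists_map_incl_eq d hd _ hW
  obtain ⟨γ, rfl⟩ := GenLoop.toFamily_surjective c
  refine ⟨⟦γ⟧, (hiff γ).2 hc, fun γ' hγ' => ?_⟩
  obtain ⟨c', rfl⟩ := Quotient.exists_rep γ'
  exact Quotient.sound (GenLoop.mk_toFamily_eq.1
    (h.map_incl_injective hs d hd _ (((hiff c').1 hγ').trans hc.symm)))

/-! ### `H`-splittings in terms of loop classes -/

section HMap

variable {F E B : Type*} [TopologicalSpace F] [TopologicalSpace E] [TopologicalSpace B]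
  {f₀ : F} {e₀ : E} {b₀ : B}

/-- A pointed map into a loop space as a family of loops. -/
def LoopFamily.ofMap {X Y : Type*} [TopologicalSpace X] [TopologicalSpace Y] {x : X} {y : Y}
    (f : C(X, Ω Y y)) (hf : f x = HSpace.e) : LoopFamily {x} y :=
  ⟨f, fun z hz => by rw [Set.mem_singleton_iff.1 hz]; exact hf⟩

/-- The universal case: the four projections of `(ΩB × ΩF)²` are families of loops, and the two maps
to be compared represent the two products of their classes. -/
theorem isHMap_loopSplitting_iff (s : C(B, E)) (hs : s b₀ = e₀) (i : C(F, E)) (hi : i f₀ = e₀) :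
    IsHMap (loopSplitting s hs i hi) ↔
      let X := (Ω B b₀ × Ω F f₀) × (Ω B b₀ × Ω F f₀)
      let e : X := (HSpace.e, HSpace.e)
      let β₁ : LoopClass {e} b₀ := .mk (.ofMap ⟨fun q => q.1.1, by fun_prop⟩ rfl)
      let β₂ : LoopClass {e} b₀ := .mk (.ofMap ⟨fun q => q.2.1, by fun_prop⟩ rfl)
      let φ₁ : LoopClass {e} f₀ := .mk (.ofMap ⟨fun q => q.1.2, by fun_prop⟩ rfl)
      let φ₂ : LoopClass {e} f₀ := .mk (.ofMap ⟨fun q => q.2.2, by fun_prop⟩ rfl)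
      LoopClass.map s hs (β₁ * β₂) * LoopClass.map i hi (φ₁ * φ₂) =
        (LoopClass.map s hs β₁ * LoopClass.map i hi φ₁) *
          (LoopClass.map s hs β₂ * LoopClass.map i hi φ₂) := by
  let X := (Ω B b₀ × Ω F f₀) × (Ω B b₀ × Ω F f₀)
  let e : X := (HSpace.e, HSpace.e)
  let β₁ : LoopFamily {e} b₀ := .ofMap ⟨fun q => q.1.1, by fun_prop⟩ rfl
  let β₂ : LoopFamily {e} b₀ := .ofMap ⟨fun q => q.2.1, by fun_prop⟩ rfl
  let φ₁ : LoopFamily {e} f₀ := .ofMap ⟨fun q => q.1.2, by fun_prop⟩ rfl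
  let φ₂ : LoopFamily {e} f₀ := .ofMap ⟨fun q => q.2.2, by fun_prop⟩ rfl
  exact (and_iff_right (loopSplitting_e s hs i hi)).trans
    (LoopClass.mk_eq (f := (β₁ * β₂).map s hs * (φ₁ * φ₂).map i hi)
      (g := (β₁.map s hs * φ₁.map i hi) * (β₂.map s hs * φ₂.map i hi))).symm

/-- If `s` and `i` are the restrictions of a map `B × F → E`, then `Ωs` and `Ωi` commute. -/
theorem LoopClass.map_mul_comm_of_prod (s : C(B, E)) (hs : s b₀ = e₀) (i : C(F, E)) (hi : i f₀ = e₀)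
    (μ : C(B × F, E)) (hμs : ∀ b, μ (b, f₀) = s b) (hμi : ∀ f, μ (b₀, f) = i f) {X : Type*}
    [TopologicalSpace X] {S : Set X} (β : LoopClass S b₀) (φ : LoopClass S f₀) :
    LoopClass.map s hs β * LoopClass.map i hi φ = LoopClass.map i hi φ * LoopClass.map s hs β := by
  obtain ⟨β⟩ := β
  obtain ⟨φ⟩ := φ
  let pair (β : LoopFamily S b₀) (φ : LoopFamily S f₀) : LoopFamily S (b₀, f₀) :=
    ⟨⟨fun x => (β.1 x).prod (φ.1 x), Path.continuous_uncurry_iff.mp (by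
      change Continuous fun q : X × I => (β.1 q.1 q.2, φ.1 q.1 q.2)
      fun_prop)⟩, fun x hx => by rw [ContinuousMap.coe_mk, β.2 x hx, φ.2 x hx]; rfl⟩
  have hpair : ∀ {β β' φ φ'}, β ≈ β' → φ ≈ φ' → mk (pair β φ) = mk (pair β' φ') := by
    intro β β' φ φ' h h'
    obtain ⟨G⟩ : β.1.HomotopicRel β'.1 S := h
    obtain ⟨H⟩ : φ.1.HomotopicRel φ'.1 S := h'
    refine Quotient.sound (LoopFamily.equiv_of_path (fun t x => (G (t, x)).prod (H (t, x)))
      ?_ ?_ ?_ ?_)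
    · change Continuous fun q : (I × X) × I => (G q.1 q.2, H q.1 q.2)
      exact ((G.continuous.comp continuous_fst).eval continuous_snd).prodMk
        ((H.continuous.comp continuous_fst).eval continuous_snd)
    · intro x; rw [G.apply_zero, H.apply_zero]; rfl
    · intro x; rw [G.apply_one, H.apply_one]; rfl
    · intro t x hx
      rw [G.eq_fst t hx, H.eq_fst t hx, β.2 x hx, φ.2 x hx]
      rfl
  have hμ : μ (b₀, f₀) = e₀ := (hμs b₀).trans hs
  -- On each half of the interval one coordinate rests at its base point, so `μ` reduces to `s` or
  -- `i` and the families agree exactly.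
  have h1 : mk (β.map s hs * φ.map i hi) = map μ hμ (mk (pair (β * 1) (1 * φ))) := by
    refine congrArg mk (Subtype.ext (ContinuousMap.ext fun x => ?_))
    ext t
    change ((loopMap s hs (β.1 x)).trans (loopMap i hi (φ.1 x))) t =
      μ (((β.1 x).trans (Path.refl b₀)) t, ((Path.refl f₀).trans (φ.1 x)) t)
    simp only [Path.trans_apply]
    split_ifs
    · exact (hμs _).symm
    · exact (hμi _).symm
  have h2 : mk (φ.map i hi * β.map s hs) = map μ hμ (mk (pair (1 * β) (φ * 1))) := by
    refine congrArg mk (Subtype.ext (ContinuousMap.ext fun x => ?_))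
    ext t
    change ((loopMap i hi (φ.1 x)).trans (loopMap s hs (β.1 x))) t =
      μ (((Path.refl b₀).trans (β.1 x)) t, ((φ.1 x).trans (Path.refl f₀)) t)
    simp only [Path.trans_apply]
    split_ifs
    · exact (hμi _).symm
    · exact (hμs _).symm
  change mk (β.map s hs * φ.map i hi) = mk (φ.map i hi * β.map s hs)
  rw [h1, h2]
  refine congrArg _ (hpair (Quotient.exact (?_ : mk (β * 1) = mk (1 * β)))
    (Quotient.exact (?_ : mk (1 * φ) = mk (φ * 1)))) <;>
  rw [mk_mul, mk_mul, mk_one, mul_one, one_mul]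

theorem isHMap_loopSplitting_of_prod (s : C(B, E)) (hs : s b₀ = e₀) (i : C(F, E)) (hi : i f₀ = e₀)
    (μ : C(B × F, E)) (hμs : ∀ b, μ (b, f₀) = s b) (hμi : ∀ f, μ (b₀, f) = i f) :
    IsHMap (loopSplitting s hs i hi) := by
  rw [isHMap_loopSplitting_iff]
  intro X e β₁ β₂ φ₁ φ₂
  have h := LoopClass.map_mul_comm_of_prod s hs i hi μ hμs hμi β₂ φ₁
  rw [map_mul, map_mul, mul_assoc, ← mul_assoc _ (LoopClass.map i hi φ₁), h, mul_assoc, mul_assoc]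

/-- If `Ωs · Ωi` is an `H`-map, then `Ωs` and `Ωi` commute up to homotopy. -/
theorem IsHMap.homotopicRel_comm {s : C(B, E)} {hs : s b₀ = e₀} {i : C(F, E)} {hi : i f₀ = e₀}
    (h : IsHMap (loopSplitting s hs i hi)) :
    ContinuousMap.HomotopicRel (X := Ω B b₀ × Ω F f₀)
      (transMap ((loopMap s hs).comp ContinuousMap.fst) ((loopMap i hi).comp ContinuousMap.snd))
      (transMap ((loopMap i hi).comp ContinuousMap.snd) ((loopMap s hs).comp ContinuousMap.fst))
      {HSpace.e} := by
  rw [isHMap_loopSplitting_iff] at h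
  let β : LoopFamily {(HSpace.e : Ω B b₀ × Ω F f₀)} b₀ := .ofMap ContinuousMap.fst rfl
  let φ : LoopFamily {(HSpace.e : Ω B b₀ × Ω F f₀)} f₀ := .ofMap ContinuousMap.snd rfl
  -- On the pairs `((1, φ), (β, 1))` the identity becomes `s_*β · i_*φ = i_*φ · s_*β`.
  let u : C(Ω B b₀ × Ω F f₀, (Ω B b₀ × Ω F f₀) × (Ω B b₀ × Ω F f₀)) :=
    ⟨fun q => ((Path.refl b₀, q.2), (q.1, Path.refl f₀)), by fun_prop⟩
  have hu : ∀ x ∈ ({HSpace.e} : Set (Ω B b₀ × Ω F f₀)), u x ∈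
      ({(HSpace.e, HSpace.e)} : Set ((Ω B b₀ × Ω F f₀) × (Ω B b₀ × Ω F f₀))) := fun x hx => by
    rw [Set.mem_singleton_iff.1 hx]; rfl
  have h1 : LoopClass.map s hs (1 * LoopClass.mk β) * LoopClass.map i hi (LoopClass.mk φ * 1) =
      (LoopClass.map s hs 1 * LoopClass.map i hi (LoopClass.mk φ)) *
        (LoopClass.map s hs (LoopClass.mk β) * LoopClass.map i hi 1) :=
    congrArg (LoopClass.comap u hu) h
  rw [one_mul, mul_one, map_one, map_one, one_mul, mul_one] at h1
  exact LoopClass.mk_eq.1 h1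

end HMap

/-! ### Maps defined on products of wedges of spheres -/

namespace SphereWedge

/-- The map on a wedge of spheres given by maps on the cells. -/
def lift {n : ℕ} {l : Fin n → ℕ} {Z : Type*} (z : Z) (φ : ∀ j, (Fin (l j + 1) → I) → Z)
    (hφ : ∀ j, ∀ y ∈ Cube.boundary (Fin (l j + 1)), φ j y = z) :
    SphereWedge (fun j => l j + 1) → Z :=
  Quot.lift (Sum.elim (fun _ => z) fun y => Quot.lift (φ y.1)
    (fun _ _ h => (hφ _ _ h.1).trans (hφ _ _ h.2).symm) y.2) (by
      rintro y w ⟨rfl, j, rfl⟩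
      exact (hφ j _ ⟨0, Or.inl rfl⟩).symm)

variable {n m : ℕ} {l : Fin n → ℕ} {k : Fin m → ℕ}

/-- The inclusion of the `j`-th sphere as a generalized loop. -/
def cellLoop (d : Fin n → ℕ) (j : Fin n) : Ω^ (Fin (d j)) (SphereWedge d) (base d) :=
  GenLoop.mapTo (Wedge.incl _ _ j) (Wedge.incl_base _ _ j) (CubeSphere.char (d j))

/-- Two maps on wedges of spheres extend to the product if the Whitehead products of their
restrictions to the spheres vanish. -/
theorem exists_prod_map {E : Type*} [TopologicalSpace E] {e₀ : E}
    (s : C(SphereWedge (fun j => l j + 1), E)) (hs : s (base _) = e₀)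
    (i : C(SphereWedge (fun r => k r + 1), E)) (hi : i (base _) = e₀)
    (h : ∀ j r, Whitehead.HasExtension (GenLoop.mapTo s hs (cellLoop (fun j => l j + 1) j))
      (GenLoop.mapTo i hi (cellLoop (fun r => k r + 1) r))) :
    ∃ μ : C(SphereWedge (fun j => l j + 1) × SphereWedge (fun r => k r + 1), E),
      (∀ b, μ (b, base _) = s b) ∧ ∀ f, μ (base _, f) = i f := by
  choose M hM using h
  have hM1 : ∀ j r x y, y ∈ Cube.boundary (Fin (k r + 1)) →
      M j r (x, y) = s (cell (fun j => l j + 1) j x) := fun j r x y hy =>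
    (hM j r _ (Or.inr hy)).trans (Whitehead.unionMap_of_right hy)
  have hM2 : ∀ j r x y, x ∈ Cube.boundary (Fin (l j + 1)) →
      M j r (x, y) = i (cell (fun r => k r + 1) r y) := fun j r x y hx =>
    (hM j r _ (Or.inl hx)).trans (Whitehead.unionMap_of_left hx)
  -- The gluing has two stages: over the cells of `F` for a fixed point of a cell of `B`, and over
  -- the cells of `B` with functions on `F` as values.
  let μ₁ (j : Fin n) (x : Fin (l j + 1) → I) : SphereWedge (fun r => k r + 1) → E :=
    lift (s (cell (fun j => l j + 1) j x)) (fun r y => M j r (x, y)) fun r y hy => hM1 j r x y hy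
  have hμ₁ : ∀ j, ∀ x ∈ Cube.boundary (Fin (l j + 1)), μ₁ j x = i := by
    intro j x hx
    funext f
    rcases base_or_cell f with rfl | ⟨r, y, rfl⟩
    · change s (cell _ j x) = _
      rw [cell_of_mem hx, hs, hi]
    · exact hM2 j r x y hx
  let μ : SphereWedge (fun j => l j + 1) → SphereWedge (fun r => k r + 1) → E := lift i μ₁ hμ₁
  -- `continuous_prod` is used once for each wedge, with the other wedge and with a cube as the
  -- locally compact factor.
  have hμ : Continuous fun q : SphereWedge (fun j => l j + 1) × SphereWedge (fun r => k r + 1) =>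
      μ q.1 q.2 := by
    refine continuous_prod i.continuous fun j => ?_
    have h1 : Continuous fun q : SphereWedge (fun r => k r + 1) × (Fin (l j + 1) → I) =>
        μ₁ j q.2 q.1 := by
      refine continuous_prod ?_ fun r => ?_
      · change Continuous fun x => s (cell (fun j => l j + 1) j x)
        fun_prop
      · exact (M j r).continuous.comp continuous_swap
    exact h1.comp continuous_swap
  refine ⟨⟨_, hμ⟩, fun b => ?_, fun f => rfl⟩
  rcases base_or_cell b with rfl | ⟨j, y, rfl⟩
  · change i (base _) = _
    rw [hs, hi]
  · rfl

end SphereWedge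

/-! ### From commuting loops to vanishing Whitehead products -/

namespace Whitehead

/-- The map `I → I` that runs through `I` on the first half. -/
def speedUp (r : I) : I := clamp (2 * (r : ℝ))

/-- The map `I → I` that runs through `I` and back. -/
def fold (r : I) : I := clamp (min (2 * (r : ℝ)) (2 - 2 * r))

@[fun_prop]
theorem continuous_speedUp : Continuous speedUp := by unfold speedUp; fun_prop

@[fun_prop]
theorem continuous_fold : Continuous fold := by unfold fold; fun_prop

@[fun_prop]
theorem continuous_stretch : Continuous stretch := by unfold stretch; fun_prop

theorem speedUp_zero : speedUp 0 = 0 := clamp_of_nonpos (by norm_num)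

theorem speedUp_of_half_le {r : I} (h : 1 / 2 ≤ (r : ℝ)) : speedUp r = 1 :=
  clamp_of_one_le (by linarith)

theorem speedUp_one : speedUp 1 = 1 := speedUp_of_half_le (by norm_num)

theorem speedUp_of_mem {r : I} (h : r = 0 ∨ r = 1) : speedUp r = 0 ∨ speedUp r = 1 :=
  h.imp (fun h => by rw [h, speedUp_zero]) fun h => by rw [h, speedUp_one]

theorem fold_of_mem {r : I} (h : r = 0 ∨ r = 1) : fold r = 0 := by
  rcases h with rfl | rfl
  · exact clamp_of_nonpos ((min_le_left _ _).trans (by norm_num))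
  · exact clamp_of_nonpos ((min_le_right _ _).trans (by norm_num))

theorem fold_of_le {r : I} (h : (r : ℝ) ≤ 1 / 2) : fold r = speedUp r := by
  rw [fold, speedUp, min_eq_left (by linarith)]

theorem fold_of_eq {r : I} (h : (r : ℝ) = 1 / 2) : fold r = 1 :=
  (fold_of_le h.le).trans (speedUp_of_half_le h.ge)

/-- Reparametrization of the first coordinate of a generalized loop. -/
def reparamFirst {n : ℕ} {X : Type*} [TopologicalSpace X] {x : X} (ρ : C(I, I)) (h0 : ρ 0 = 0)
    (h1 : ρ 1 = 1) (f : Ω^ (Fin (n + 1)) X x) : Ω^ (Fin (n + 1)) X x :=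
  ⟨⟨fun y => f (Fin.cons (ρ (y 0)) (Fin.tail y)), f.1.continuous.comp (by
      refine continuous_pi fun j => ?_
      refine Fin.cases ?_ (fun j => ?_) j
      · simp only [Fin.cons_zero]; fun_prop
      · simp only [Fin.cons_succ, Fin.tail]; fun_prop)⟩, by
    rintro y ⟨j, hj⟩
    refine f.2 _ ⟨j, ?_⟩
    revert hj
    refine Fin.cases (fun hj => ?_) (fun j hj => ?_) j
    · rcases hj with hj | hj <;> simp [hj, h0, h1]
    · simpa [Fin.tail] using hj⟩

theorem homotopic_reparamFirst {n : ℕ} {X : Type*} [TopologicalSpace X] {x : X} (ρ : C(I, I))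
    (h0 : ρ 0 = 0) (h1 : ρ 1 = 1) (f : Ω^ (Fin (n + 1)) X x) :
    GenLoop.Homotopic (reparamFirst ρ h0 h1 f) f := by
  refine GenLoop.homotopic_iff.2 (Setoid.symm (LoopFamily.reparam_equiv ρ ρ.continuous h0 h1
    fun y => ?_))
  ext t
  change f (Fin.cons (ρ ((Fin.cons t y : Fin (n + 1) → I) 0))
    (Fin.tail (Fin.cons t y : Fin (n + 1) → I))) = _
  rw [Fin.cons_zero, Fin.tail_cons]
  rfl

/-- A family of squares in `X`, whose edges are the loops `A p` and `C q`, can be modified to an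
extension of the map `f ∪ g` defined by these loops. -/
theorem hasExtension_of_squares {a b : ℕ} {P Q X : Type*} [TopologicalSpace P]
    [TopologicalSpace Q] [TopologicalSpace X] {x : X} (K : C((P × Q) × (I × I), X)) (p₀ : P)
    (q₀ : Q) (A : P → I → X) (C : Q → I → X)
    (hA : ∀ p q t u, u = 0 ∨ u = 1 → K ((p, q), (t, u)) = A p t)
    (hC : ∀ p q t u, t = 0 ∨ t = 1 → K ((p, q), (t, u)) = C q u)
    (hK : ∀ z, K ((p₀, q₀), z) = x)
    (F : C(Fin a → I, P)) (hF : ∀ y ∈ Cube.boundary (Fin a), F y = p₀)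
    (G : C(Fin b → I, Q)) (hG : ∀ y ∈ Cube.boundary (Fin b), G y = q₀)
    {f : Ω^ (Fin (a + 1)) X x} {g : Ω^ (Fin (b + 1)) X x}
    (hf : ∀ y, f y = A (F (Fin.tail y)) (speedUp (y 0)))
    (hg : ∀ y, g y = C (G (Fin.tail y)) (speedUp (y 0))) : HasExtension f g := by
  classical
  have hA0 : ∀ t, A p₀ t = x := fun t => (hA p₀ q₀ t 0 (Or.inl rfl)).symm.trans (hK _)
  have hC0 : ∀ u, C q₀ u = x := fun u => (hC p₀ q₀ 0 u (Or.inl rfl)).symm.trans (hK _)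
  have hKF : ∀ y ∈ Cube.boundary (Fin (a + 1)), ∀ q u,
      K ((F (Fin.tail y), q), (fold (y 0), u)) = K ((p₀, q), (fold (y 0), u)) := by
    rintro y ⟨j, hj⟩ q u
    revert hj
    refine Fin.cases (fun hj => ?_) (fun j hj => ?_) j
    · rw [hC _ _ _ _ (Or.inl (fold_of_mem hj)), hC _ _ _ _ (Or.inl (fold_of_mem hj))]
    · rw [hF (Fin.tail y) ⟨j, hj⟩]
  have hKG : ∀ z ∈ Cube.boundary (Fin (b + 1)), ∀ p t,
      K ((p, G (Fin.tail z)), (t, fold (z 0))) = K ((p, q₀), (t, fold (z 0))) := by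
    rintro z ⟨j, hj⟩ p t
    revert hj
    refine Fin.cases (fun hj => ?_) (fun j hj => ?_) j
    · rw [hA _ _ _ _ (Or.inl (fold_of_mem hj)), hA _ _ _ _ (Or.inl (fold_of_mem hj))]
    · rw [hG (Fin.tail z) ⟨j, hj⟩]
  have hT : ∀ n, Continuous fun y : Fin (n + 1) → I => Fin.tail y := fun n => by
    unfold Fin.tail; fun_prop
  have hTa := hT a
  have hTb := hT b
  -- The squares over `(p₀, q)` have edges `C q` but may vary with `t` in between, so `K` itself has
  -- the wrong boundary values. The homotopy `h` shrinks `fold` to `0`, where only the edge is left;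
  -- likewise for the squares over `(p, q₀)`.
  let h : ((Fin (a + 1) → I) × (Fin (b + 1) → I)) × I → X := fun w =>
    if w.1.1 ∈ Cube.boundary (Fin (a + 1)) then
      K ((p₀, G (Fin.tail w.1.2)), (w.2 * fold (w.1.1 0), speedUp (w.1.2 0)))
    else K ((F (Fin.tail w.1.1), q₀), (speedUp (w.1.1 0), w.2 * fold (w.1.2 0)))
  have h1 : ∀ z ∈ Cube.boundary (Fin (b + 1)), ∀ t,
      K ((p₀, G (Fin.tail z)), (t, speedUp (z 0))) = x := by
    rintro z ⟨j, hj⟩ t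
    revert hj
    refine Fin.cases (fun hj => ?_) (fun j hj => ?_) j
    · rw [hA _ _ _ _ (speedUp_of_mem hj), hA0]
    · rw [hG (Fin.tail z) ⟨j, hj⟩, hK]
  have h2 : ∀ y ∈ Cube.boundary (Fin (a + 1)), ∀ u,
      K ((F (Fin.tail y), q₀), (speedUp (y 0), u)) = x := by
    rintro y ⟨j, hj⟩ t
    revert hj
    refine Fin.cases (fun hj => ?_) (fun j hj => ?_) j
    · rw [hC _ _ _ _ (speedUp_of_mem hj), hC0]
    · rw [hF (Fin.tail y) ⟨j, hj⟩, hK]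
  have hc : ContinuousOn h {w | w.1 ∈ Cube.prodBoundary (Fin (a + 1)) (Fin (b + 1))} := by
    refine continuousOn_ite_of_isClosed
      (P := fun w : ((Fin (a + 1) → I) × (Fin (b + 1) → I)) × I =>
        w.1.1 ∈ Cube.boundary (Fin (a + 1)))
      (Q := fun w => w.1.2 ∈ Cube.boundary (Fin (b + 1)))
      ((Cube.isClosed_boundary _).preimage (by fun_prop))
      ((Cube.isClosed_boundary _).preimage (by fun_prop)) ?_ ?_ fun w hw hw' => ?_
    · exact Continuous.continuousOn (by fun_prop)
    · exact Continuous.continuousOn (by fun_prop)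
    · rw [h1 _ hw', h2 _ hw]
  -- Doubling: once a first coordinate passes `1 / 2`, the parameter of its factor is replaced by
  -- the base point and the square is run backwards. The pieces match because at `fold = 1` the
  -- value depends only on the other parameter. On the boundary the unwanted variation now enters
  -- through `fold`, as in `h` at time `1`.
  let M : (Fin (a + 1) → I) × (Fin (b + 1) → I) → X := fun w =>
    if (w.1 0 : ℝ) ≤ 1 / 2 then
      if (w.2 0 : ℝ) ≤ 1 / 2 then
        K ((F (Fin.tail w.1), G (Fin.tail w.2)), (fold (w.1 0), fold (w.2 0)))
      else K ((F (Fin.tail w.1), q₀), (fold (w.1 0), fold (w.2 0)))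
    else
      if (w.2 0 : ℝ) ≤ 1 / 2 then
        K ((p₀, G (Fin.tail w.2)), (fold (w.1 0), fold (w.2 0)))
      else x
  have hM : Continuous M := by
    refine continuous_if_le (by fun_prop) (by fun_prop) (Continuous.continuousOn ?_)
      (Continuous.continuousOn ?_) fun w hw => ?_
    · refine continuous_if_le (by fun_prop) (by fun_prop) (Continuous.continuousOn (by fun_prop))
        (Continuous.continuousOn (by fun_prop)) fun w hw => ?_
      rw [fold_of_eq hw, hA _ _ _ _ (Or.inr rfl), hA _ _ _ _ (Or.inr rfl)]
    · refine continuous_if_le (by fun_prop) (by fun_prop) (Continuous.continuousOn (by fun_prop))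
        (Continuous.continuousOn (by fun_prop)) fun w hw => ?_
      rw [fold_of_eq hw, hA _ _ _ _ (Or.inr rfl), hA0]
    · split_ifs
      · rw [fold_of_eq hw, hC _ _ _ _ (Or.inr rfl), hC _ _ _ _ (Or.inr rfl)]
      · rw [fold_of_eq hw, hC _ _ _ _ (Or.inr rfl), hC0]
  obtain ⟨N, hN⟩ := Cube.exists_extension_prod hc ⟨M, hM⟩ (by
    rintro ⟨y, z⟩ hw
    by_cases hy : y ∈ Cube.boundary (Fin (a + 1))
    · simp only [h, hy, if_true, one_mul]
      change M (y, z) = _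
      simp only [M, hKF y hy, ite_self, hK]
      split_ifs with hz
      · rw [fold_of_le hz]
      · rw [speedUp_of_half_le (not_le.1 hz).le, hA _ _ _ _ (Or.inr rfl), hA0]
    · have hz : z ∈ Cube.boundary (Fin (b + 1)) := hw.resolve_left hy
      simp only [h, hy, if_false, one_mul]
      change M (y, z) = _
      simp only [M, hKG z hz, ite_self, hK]
      split_ifs with hy'
      · rw [fold_of_le hy']
      · rw [speedUp_of_half_le (not_le.1 hy').le, hC _ _ _ _ (Or.inr rfl), hC0])
  refine ⟨N, ?_⟩
  rintro ⟨y, z⟩ hw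
  refine (hN _ hw).trans ?_
  by_cases hy : y ∈ Cube.boundary (Fin (a + 1))
  · rw [unionMap_of_left hy]
    simp only [h, hy, if_true, zero_mul]
    rw [hC _ _ _ _ (Or.inl rfl)]
    exact (hg z).symm
  · rw [unionMap_of_right (hw.resolve_left hy)]
    simp only [h, hy, if_false, zero_mul]
    rw [hA _ _ _ _ (Or.inl rfl)]
    exact (hf y).symm

theorem trans_first {X : Type*} [TopologicalSpace X] {x : X} (γ γ' : Ω X x) (r : I) :
    (γ.trans γ') (clamp ((r : ℝ) / 2)) = γ r := by
  have h1 := r.2.1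
  have h2 := r.2.2
  have hc : ((clamp ((r : ℝ) / 2) : I) : ℝ) = r / 2 := by
    rw [clamp, Set.coe_projIcc, min_eq_right (by linarith), max_eq_right (by linarith)]
  rw [Path.trans_apply, dif_pos (by rw [hc]; linarith)]
  congr 1
  refine Subtype.ext ?_
  change 2 * ((clamp ((r : ℝ) / 2) : I) : ℝ) = r
  rw [hc]
  ring

theorem trans_second {X : Type*} [TopologicalSpace X] {x : X} (γ γ' : Ω X x) (r : I) :
    (γ.trans γ') (clamp ((1 + r : ℝ) / 2)) = γ' r := by
  have h := trans_first γ'.symm γ.symm (σ r)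
  rw [← Path.trans_symm] at h
  refine Eq.trans ?_ (h.trans ?_)
  · change _ = (γ.trans γ') (σ _)
    congr 1
    have h1 := r.2.1
    have h2 := r.2.2
    refine Subtype.ext ?_
    rw [unitInterval.coe_symm_eq, clamp, clamp, Set.coe_projIcc, Set.coe_projIcc,
      unitInterval.coe_symm_eq, min_eq_right (by linarith), max_eq_right (by linarith),
      min_eq_right (by linarith), max_eq_right (by linarith)]
    ring
  · change γ' (σ (σ r)) = _
    rw [unitInterval.symm_symm]

end Whitehead

open Whitehead in
/-- If `Ωs · Ωi` is an `H`-map, then the Whitehead products `[s_* f, i_* g]` vanish. -/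
theorem IsHMap.genLoop_homotopic_const {F E B : Type*} [TopologicalSpace F] [TopologicalSpace E]
    [TopologicalSpace B] {f₀ : F} {e₀ : E} {b₀ : B} {s : C(B, E)} {hs : s b₀ = e₀} {i : C(F, E)}
    {hi : i f₀ = e₀} (h : IsHMap (loopSplitting s hs i hi)) {a b : ℕ}
    (f : Ω^ (Fin (a + 1)) B b₀) (g : Ω^ (Fin (b + 1)) F f₀) :
    GenLoop.Homotopic (genLoop (GenLoop.mapTo s hs f) (GenLoop.mapTo i hi g)) GenLoop.const := by
  obtain ⟨H⟩ := h.homotopicRel_comm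
  -- Loop time grows along the diagonal of the square, the parameter of the commuting homotopy along
  -- the antidiagonal. Near the corners `(0, 0)` and `(1, 1)` `stretch` pauses and the loop is at
  -- `e₀`, so the parameter can change unseen on the edges; the factor `3 / 2` brings it to `0` or
  -- `1` within that third. Elsewhere an edge sees one half of one of the two concatenations.
  let K : C((Ω B b₀ × Ω F f₀) × (I × I), E) :=
    ⟨fun q => H (clamp (1 / 2 + 3 / 2 * ((q.2.2 : ℝ) - q.2.1)), q.1)
      (clamp (((stretch q.2.1 : ℝ) + stretch q.2.2) / 2)), by fun_prop⟩
  have hK : ∀ p t u, K (p, (t, u)) = H (clamp (1 / 2 + 3 / 2 * ((u : ℝ) - t)), p)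
      (clamp (((stretch t : ℝ) + stretch u) / 2)) := fun _ _ _ => rfl
  have hs0 : ∀ {r : I}, (r : ℝ) ≤ 1 / 3 → stretch r = 0 := fun h =>
    clamp_of_nonpos (by linarith)
  have hs1 : ∀ {r : I}, 2 / 3 ≤ (r : ℝ) → stretch r = 1 := fun h =>
    clamp_of_one_le (by linarith)
  have hH0 : ∀ p τ, H (0, p) τ = ((loopMap s hs p.1).trans (loopMap i hi p.2)) τ := fun p τ => by
    rw [H.apply_zero]; rfl
  have hH1 : ∀ p τ, H (1, p) τ = ((loopMap i hi p.2).trans (loopMap s hs p.1)) τ := fun p τ => by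
    rw [H.apply_one]; rfl
  let ρ : C(I, I) := ⟨fun r => stretch (speedUp r), by fun_prop⟩
  have hρ0 : ρ 0 = 0 := (congrArg stretch speedUp_zero).trans (stretch_of_mem (Or.inl rfl))
  have hρ1 : ρ 1 = 1 := (congrArg stretch speedUp_one).trans (stretch_of_mem (Or.inr rfl))
  have hext : HasExtension (reparamFirst ρ hρ0 hρ1 (GenLoop.mapTo s hs f))
      (reparamFirst ρ hρ0 hρ1 (GenLoop.mapTo i hi g)) := by
    refine hasExtension_of_squares K (Path.refl b₀) (Path.refl f₀)
      (fun p t => loopMap s hs p (stretch t)) (fun q u => loopMap i hi q (stretch u))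
      ?_ ?_ ?_ (GenLoop.toFamily f).1 (GenLoop.toFamily f).2 (GenLoop.toFamily g).1
      (GenLoop.toFamily g).2 (fun y => rfl) (fun y => rfl)
    · rintro p q t u (rfl | rfl)
      · rw [hK, stretch_of_mem (Or.inl rfl), Set.Icc.coe_zero, add_zero]
        rcases le_total (t : ℝ) (1 / 3) with ht | ht
        · rw [hs0 ht, Path.source, clamp_of_nonpos (r := _ / 2) (by norm_num), Path.source]
        · rw [clamp_of_nonpos (by linarith), hH0, trans_first]
      · rw [hK, stretch_of_mem (Or.inr rfl), Set.Icc.coe_one, add_comm (stretch t : ℝ)]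
        rcases le_total (2 / 3) (t : ℝ) with ht | ht
        · rw [hs1 ht, Path.target, clamp_of_one_le (r := (1 + _) / 2) (by norm_num), Path.target]
        · rw [clamp_of_one_le (by linarith), hH1, trans_second]
    · rintro p q t u (rfl | rfl)
      · rw [hK, stretch_of_mem (Or.inl rfl), Set.Icc.coe_zero, zero_add]
        rcases le_total (u : ℝ) (1 / 3) with hu | hu
        · rw [hs0 hu, Path.source, clamp_of_nonpos (r := _ / 2) (by norm_num), Path.source]
        · rw [clamp_of_one_le (by linarith), hH1, trans_first]
      · rw [hK, stretch_of_mem (Or.inr rfl), Set.Icc.coe_one]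
        rcases le_total (2 / 3) (u : ℝ) with hu | hu
        · rw [hs1 hu, Path.target, clamp_of_one_le (r := (1 + _) / 2) (by norm_num), Path.target]
        · rw [clamp_of_nonpos (by linarith), hH0, trans_second]
    · rintro ⟨t, u⟩
      have hH := H.eq_fst (clamp (1 / 2 + 3 / 2 * ((u : ℝ) - t))) (x := (Path.refl b₀, Path.refl f₀))
        rfl
      rw [hK, hH]
      change ((loopMap s hs (Path.refl b₀)).trans (loopMap i hi (Path.refl f₀))) _ = e₀
      rw [loopMap_refl, loopMap_refl, Path.refl_trans_refl]
      rfl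
  -- The extension belongs to the loops reparametrized by `ρ`, which represent the same classes.
  exact (genLoop_homotopic (homotopic_reparamFirst ρ hρ0 hρ1 _).symm
    (homotopic_reparamFirst ρ hρ0 hρ1 _).symm).trans hext.genLoop_homotopic_const

end

/-! ### The characterization of `H`-splittings -/

theorem mainTheorem12 {m n : ℕ} (k : Fin m → ℕ) (l : Fin n → ℕ)
    (hk : ∀ r, 2 ≤ k r + 1) (hl : ∀ j, 2 ≤ l j + 1)
    {E : Type u} [TopologicalSpace E] (e₀ : E)
    (i : C(SphereWedge (fun r => k r + 1), E)) (p : C(E, SphereWedge (fun j => l j + 1)))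
    (s : C(SphereWedge (fun j => l j + 1), E))
    (hfib : IsFibrationSequence (SphereWedge.base _) e₀ (SphereWedge.base _) i p)
    (hsec : IsHomotopySection e₀ (SphereWedge.base _) p s) :
    (∀ j r, ∃! γ, IsJamesBrace s hsec.map_base i hfib.map_base
      (SphereWedge.inclClass (fun j => l j + 1) j)
      (SphereWedge.inclClass (fun r => k r + 1) r) γ) ∧
    (IsHSplitting (loopSplitting s hsec.map_base i hfib.map_base) ↔
      ∀ j r, jamesBrace s hsec.map_base i hfib.map_base
        (SphereWedge.inclClass (fun j => l j + 1) j)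
        (SphereWedge.inclClass (fun r => k r + 1) r) = 1) := by
  obtain ⟨d, hd⟩ := SphereWedge.exists_eq_zero_iff_eq_base l
  have huniq := fun j r => hfib.existsUnique_isJamesBrace hsec d hd
    (SphereWedge.inclClass (fun j => l j + 1) j) (SphereWedge.inclClass (fun r => k r + 1) r)
  -- By uniqueness, the chosen brace product is trivial exactly when the trivial class satisfies its
  -- defining equation.
  have hone : ∀ j r, jamesBrace s hsec.map_base i hfib.map_base
        (SphereWedge.inclClass (fun j => l j + 1) j)
        (SphereWedge.inclClass (fun r => k r + 1) r) = 1 ↔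
      GenLoop.Homotopic (Whitehead.genLoop
        (GenLoop.mapTo s hsec.map_base (SphereWedge.cellLoop (fun j => l j + 1) j))
        (GenLoop.mapTo i hfib.map_base (SphereWedge.cellLoop (fun r => k r + 1) r)))
        GenLoop.const := fun j r => by
    have hspec := Classical.epsilon_spec (huniq j r).exists
    have hbr : IsJamesBrace s hsec.map_base i hfib.map_base
        (SphereWedge.inclClass (fun j => l j + 1) j)
        (SphereWedge.inclClass (fun r => k r + 1) r) 1 ↔
        GenLoop.Homotopic (Whitehead.genLoop
          (GenLoop.mapTo s hsec.map_base (SphereWedge.cellLoop (fun j => l j + 1) j))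
          (GenLoop.mapTo i hfib.map_base (SphereWedge.cellLoop (fun r => k r + 1) r)))
          GenLoop.const := by
      have hconst : piMap i hfib.map_base (1 : π_ (l j + k r + 1) _ _) = ⟦GenLoop.const⟧ := by
        rw [HomotopyGroup.one_def]
        exact congrArg (Quotient.mk _) (GenLoop.ext _ _ fun _ => hfib.map_base)
      rw [IsJamesBrace, hconst]
      exact ⟨fun h => Quotient.exact h.symm, fun h => (Quotient.sound h).symm⟩
    rw [← hbr]
    exact ⟨fun h => h ▸ hspec, fun h => (huniq j r).unique hspec h⟩
  refine ⟨huniq, fun h j r => (hone j r).2 (h.1.genLoop_homotopic_const _ _), fun h =>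
    ⟨?_, hfib.isPointedHomotopyEquiv_loopSplitting hsec d hd⟩⟩
  obtain ⟨μ, hμs, hμi⟩ := SphereWedge.exists_prod_map s hsec.map_base i hfib.map_base fun j r =>
    Whitehead.hasExtension_of_genLoop_homotopic_const ((hone j r).1 (h j r))
  exact isHMap_loopSplitting_of_prod s hsec.map_base i hfib.map_base μ hμs hμi
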